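/- Let $\mathbb{F}$ be a field with $|\mathbb{F}|>2$, let $V$ be an $\mathbb{F}$-vector space of finite dimension $n\ge 3$ with a fixed basis $v_1,\dots,v_n$, and let $G=GL(V)$. Let $\boldsymbol\Lambda=\mathbb{F}^{n^3}$ be the space of structure vectors $\boldsymbol\lambda=(\lambda_{ijk})$ of (not necessarily associative) algebras on $V$, where the algebra with product $[\,,]$ has structure vector given by $[v_i,v_j]=\sum_k\lambda_{ijk}v_k$. The group $G$ acts linearly on $\boldsymbol\Lambda$ on the right: if $\boldsymbol\lambda$ corresponds to $[\,,]$, then $\boldsymbol\lambda g$ corresponds to $[u,v]'=g^{-1}[gu,gv]$. Consider the following $G$-submodules of $\boldsymbol\Lambda$, described by the corresponding algebras: * $\mathcal{C}$: $[u,v]=[v,u]$ for all $u,v\in V$; * $\mathcal{K}$: $[v,v]=0$ for all $v\in V$; * $\mathcal{T}$: the map $v\mapsto[u,v]$ has trace $0$ for every $u\in V$; * $\mathcal{U}=\mathcal{K}\cap\mathcal{T}$ and $\mathcal{N}=\mathcal{C}\cap\mathcal{T}$; * $\mathcal{M}^*_{(p,q)}$ (for $p,q\in\mathbb{F}$): $[u,v]=p\,\theta(v)u+q\,\theta(u)v$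 for some linear functional $\theta$ on $V$; * $\mathcal{M}^{**}$: $[v,v]\in\mathbb{F}v$ for all $v\in V$. Let $\widehat V$ be the dual space with $(\varphi g)(v)=\varphi(gv)$. If $\mathrm{char}\,\mathbb{F}=2$, let $\Gamma V$ be the space of maps $V\to V$ that are semilinear with respect to $\alpha\mapsto\alpha^2$, with $\varphi*g=g^{-1}\circ\varphi\circ g$. A "proper submodule" below means a $G$-submodule that is neither $0$ nor the whole module. **(1)** Suppose $\mathrm{char}\,\mathbb{F}\ne2$. Then the proper submodules of $\mathcal{C}$ are exactly $\mathcal{N}$ and $\mathcal{M}^*_{(1,1)}$. * If $\mathrm{char}\,\mathbb{F}\nmid n+1$, then $\mathcal{N}\cap\mathcal{M}^{**}=0$ and $\mathcal{C}=\mathcal{N}\oplus\mathcal{M}^*_{(1,1)}$ is a direct sum of irreducible $G$-modules, and $\mathcal{C}$ has exactly two composition series, $0\subset\mathcal{N}\subset\mathcal{C}$ and $0\subset\mathcal{M}^*_{(1,1)}\subset\mathcal{C}$. * If $\mathrm{char}\,\mathbb{F}\mid n+1$, then $0\subset\mathcal{M}^*_{(1,1)}\subset\mathcal{N}\subset\mathcal{C}$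 is the unique composition series of $\mathcal{C}$. **(2)** Suppose $\mathrm{char}\,\mathbb{F}=2$. Then the proper submodules of $\mathcal{C}$ are exactly the four distinct submodules $\mathcal{N}$, $\mathcal{M}^*_{(1,1)}=\mathcal{M}^*_{(1,-1)}$, $\mathcal{U}$ and $\mathcal{K}$. The modules $\mathcal{C},\mathcal{N},\mathcal{K},\mathcal{U}$ form a diamond: $\mathcal{N}\cap\mathcal{K}=\mathcal{U}$, $\mathcal{N}+\mathcal{K}=\mathcal{C}$, $\mathcal{U}\subsetneq\mathcal{N}$ and $\mathcal{U}\subsetneq\mathcal{K}$. Its factors satisfy $\mathcal{C}/\mathcal{N}\cong\mathcal{K}/\mathcal{U}\cong\widehat V$ and $\mathcal{C}/\mathcal{K}\cong\Gamma V$ as $G$-modules, and $\Gamma V$, $\mathcal{C}/\mathcal{K}$ and $\mathcal{N}/\mathcal{U}$ are irreducible. The maximal submodules of $\mathcal{C}$ are exactly $\mathcal{N}$ and $\mathcal{K}$. * If $n$ is odd, $\mathcal{C}$ has exactly two composition series: $0\subset\mathcal{M}^*_{(1,1)}\subset\mathcal{U}\subset\mathcal{K}\subset\mathcal{C}$ and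 $0\subset\mathcal{M}^*_{(1,1)}\subset\mathcal{U}\subset\mathcal{N}\subset\mathcal{C}$. * If $n$ is even, $\mathcal{K}=\mathcal{U}\oplus\mathcal{M}^*_{(1,1)}$ is a direct sum of irreducible $G$-modules, and $\mathcal{C}$ has exactly three composition series: $0\subset\mathcal{U}\subset\mathcal{K}\subset\mathcal{C}$, $0\subset\mathcal{M}^*_{(1,1)}\subset\mathcal{K}\subset\mathcal{C}$ and $0\subset\mathcal{U}\subset\mathcal{N}\subset\mathcal{C}$. -/

import Mathlib

open MulOpposite

noncomputable section

namespace AlgStr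

section Lattice

variable {A G W : Type*} [Ring A] [Monoid G] [AddCommGroup W] [Module A W]

instance instIsModularLattice (ρ : Representation A G W) :
    IsModularLattice (Subrepresentation ρ) where
  sup_inf_le_assoc_of_le {x} y {z} h :=
    IsModularLattice.sup_inf_le_assoc_of_le (α := Submodule A W)
      (x := x.toSubmodule) y.toSubmodule (z := z.toSubmodule) h

variable {ρ : Representation A G W}

/-- The non-zero proper `G`-submodules of the `G`-submodule `X`. -/
def properSubmodules (X : Subrepresentation ρ) : Set (Subrepresentation ρ) :=
  {S | S ≠ ⊥ ∧ S < X}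

/-- The composition series `0 = S₀ ⊂ S₁ ⊂ ⋯ ⊂ Sᵣ = X` of the `G`-submodule `X`
(each `Sᵢ` being a maximal `G`-submodule of `Sᵢ₊₁`). -/
def compositionSeriesOf (X : Subrepresentation ρ) :
    Set (CompositionSeries (Subrepresentation ρ)) :=
  {s | s.head = ⊥ ∧ s.last = X}

/-- `X = Y ⊕ Z`, an internal direct sum of `G`-submodules. -/
def IsDirectSum (X Y Z : Subrepresentation ρ) : Prop :=
  Y ⊓ Z = ⊥ ∧ Y ⊔ Z = X

end Lattice

/-- The quotient `G`-module `X / (X ∩ Y)`; it is used for `Y ≤ X`, where it is `X / Y`. -/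
def quotientRep {F G W : Type*} [Field F] [Group G] [AddCommGroup W] [Module F W]
    {ρ : Representation F G W} (X Y : Subrepresentation ρ) :
    Representation F G (X.toSubmodule ⧸ Y.toSubmodule.submoduleOf X.toSubmodule) :=
  X.toRepresentation.quotient (Y.toSubmodule.submoduleOf X.toSubmodule)
    (fun g _ hx => Y.apply_mem_toSubmodule g hx)

variable {F V : Type*} [Field F] [AddCommGroup V] [Module F V] {n : ℕ}

variable (F V) in
/-- The space of (not necessarily associative) algebras on `V`, i.e. of bilinear products
`[u, v]`, written `𝔤 u v`. -/
abbrev Alg := V →ₗ[F] V →ₗ[F] V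

variable (F n) in
/-- The space `Λ = F^(n³)` of structure vectors `(λ_{ijk})`. -/
abbrev StrVec := Fin n → Fin n → Fin n → F

/-- The structure vector of an algebra relative to the basis `b`:
`[b i, b j] = ∑ k, λ_{ijk} b k`. -/
def Θ (b : Module.Basis (Fin n) F V) : Alg F V ≃ₗ[F] StrVec F n where
  toFun 𝔤 i j k := b.repr (𝔤 (b i) (b j)) k
  map_add' 𝔤 𝔥 := by ext; simp
  map_smul' c 𝔤 := by ext; simp
  invFun l := b.constr F fun i => b.constr F fun j => ∑ k, l i j k • b k
  left_inv 𝔤 := by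
    refine b.ext fun i => b.ext fun j => ?_
    simp [b.sum_repr]
  right_inv l := by
    ext i j k
    simp [Finsupp.single_apply]

/-- The algebra `𝔤 g`, with product `[u, v]' = g⁻¹ [g u, g v]`. -/
def algAct (g : V ≃ₗ[F] V) : Alg F V →ₗ[F] Alg F V where
  toFun 𝔤 := LinearMap.mk₂ F (fun u v => g.symm (𝔤 (g u) (g v)))
    (by simp) (by simp) (by simp) (by simp)
  map_add' 𝔤 𝔥 := by ext; simp
  map_smul' c 𝔤 := by ext; simp

/-- The right `GL(V)`-module `Λ`, with `Θ(𝔤) g = Θ(𝔤 g)`.  Right modules are treated as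
representations of the opposite group: `repΛ b (op g) l` is `l g`. -/
def repΛ (b : Module.Basis (Fin n) F V) : Representation F (V ≃ₗ[F] V)ᵐᵒᵖ (StrVec F n) where
  toFun g := (Θ b).toLinearMap ∘ₗ algAct (unop g) ∘ₗ (Θ b).symm.toLinearMap
  map_one' := by
    refine LinearMap.ext fun l => ?_
    have : algAct (1 : V ≃ₗ[F] V) ((Θ b).symm l) = (Θ b).symm l := rfl
    simp [this]
  map_mul' g h := by
    refine LinearMap.ext fun l => ?_
    have : ∀ 𝔤 : Alg F V,
        algAct (unop h * unop g) 𝔤 = algAct (unop g) (algAct (unop h) 𝔤) := fun _ => rfl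
    simp [this]

/-- The product of `l g` is `[u, v]' = g⁻¹ [g u, g v]`. -/
theorem Θ_symm_repΛ (b : Module.Basis (Fin n) F V) (g : (V ≃ₗ[F] V)ᵐᵒᵖ) (l : StrVec F n)
    (u v : V) : (Θ b).symm (repΛ b g l) u v =
      (unop g).symm ((Θ b).symm l (unop g u) (unop g v)) := by
  simp [repΛ, algAct]

variable (F V) in
/-- The dual space as a right `GL(V)`-module: `(φ g)(v) = φ (g v)`. -/
def repDual : Representation F (V ≃ₗ[F] V)ᵐᵒᵖ (Module.Dual F V) where
  toFun g :=
    { toFun := fun φ => φ ∘ₗ (unop g).toLinearMap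
      map_add' := fun _ _ => rfl
      map_smul' := fun _ _ => rfl }
  map_one' := rfl
  map_mul' _ _ := rfl

variable (F V) in
/-- In characteristic 2, the space `ΓV` of maps `V → V` that are semilinear relative to the
Frobenius `α ↦ α²`, as a right `GL(V)`-module: `φ * g = g⁻¹ ∘ φ ∘ g`. -/
def repΓ [CharP F 2] :
    Representation F (V ≃ₗ[F] V)ᵐᵒᵖ (V →ₛₗ[frobenius F 2] V) where
  toFun g :=
    { toFun := fun φ =>
        { toFun := fun v => (unop g).symm (φ (unop g v))
          map_add' := by simp
          map_smul' := by simp }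
      map_add' := fun _ _ => by ext; simp
      map_smul' := fun _ _ => by ext; simp }
  map_one' := rfl
  map_mul' _ _ := rfl

/-- `𝒞`: the algebra is commutative, `[u, v] = [v, u]`. -/
def subC (b : Module.Basis (Fin n) F V) : Subrepresentation (repΛ b) where
  toSubmodule :=
    { carrier := {l | ∀ u v, (Θ b).symm l u v = (Θ b).symm l v u}
      zero_mem' := by simp
      add_mem' := fun hx hy u v => by simp [hx u v, hy u v]
      smul_mem' := fun c x hx u v => by simp [hx u v] }
  apply_mem_toSubmodule g l hl u v := by
    rw [Θ_symm_repΛ, Θ_symm_repΛ, hl]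

/-- `𝒦`: `[v, v] = 0` for all `v`. -/
def subK (b : Module.Basis (Fin n) F V) : Subrepresentation (repΛ b) where
  toSubmodule :=
    { carrier := {l | ∀ v, (Θ b).symm l v v = 0}
      zero_mem' := by simp
      add_mem' := fun hx hy v => by simp [hx v, hy v]
      smul_mem' := fun c x hx v => by simp [hx v] }
  apply_mem_toSubmodule g l hl v := by
    rw [Θ_symm_repΛ, hl, map_zero]

/-- `𝒯`: the adjoint trace form vanishes, i.e. the trace of `ad u : v ↦ [u, v]` is `0`
for all `u` (unimodular algebras). -/
def subT (b : Module.Basis (Fin n) F V) : Subrepresentation (repΛ b) where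
  toSubmodule :=
    { carrier := {l | ∀ u, LinearMap.trace F V ((Θ b).symm l u) = 0}
      zero_mem' := by simp
      add_mem' := fun hx hy u => by simp [hx u, hy u]
      smul_mem' := fun c x hx u => by simp [hx u] }
  apply_mem_toSubmodule g l hl u := by
    have h : (Θ b).symm (repΛ b g l) u =
        (unop g).symm.conj ((Θ b).symm l (unop g u)) := by
      ext v
      rw [Θ_symm_repΛ]
      simp [LinearEquiv.conj_apply]
    rw [h, LinearMap.trace_conj', hl]

/-- `𝒰 = 𝒦 ∩ 𝒯`. -/
def subU (b : Module.Basis (Fin n) F V) : Subrepresentation (repΛ b) := subK b ⊓ subT b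

/-- `𝒩 = 𝒞 ∩ 𝒯`. -/
def subN (b : Module.Basis (Fin n) F V) : Subrepresentation (repΛ b) := subC b ⊓ subT b

/-- The algebra `𝔪_{α,δ}` with product `[u, v] = α(v) u + δ(u) v`. -/
def algM (α δ : Module.Dual F V) : Alg F V :=
  LinearMap.mk₂ F (fun u v => α v • u + δ u • v)
    (fun u u' v => by simp only [smul_add, map_add, add_smul]; abel)
    (fun c u v => by simp only [smul_add, map_smul, smul_smul, smul_eq_mul, mul_comm c])
    (fun u v v' => by simp only [smul_add, map_add, add_smul]; abel)
    (fun c u v => by simp only [smul_add, map_smul, smul_smul, smul_eq_mul, mul_comm c])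

/-- `𝓜*_{(p,q)}`: the structure vectors of the algebras `𝔪_{pθ,qθ}`, `θ` a linear functional. -/
def subMstarP (b : Module.Basis (Fin n) F V) (p q : F) : Subrepresentation (repΛ b) where
  toSubmodule :=
    { carrier := {l | ∃ θ : Module.Dual F V, l = Θ b (algM (p • θ) (q • θ))}
      zero_mem' := ⟨0, by
        have : algM (p • (0 : Module.Dual F V)) (q • 0) = 0 := by ext; simp [algM]
        rw [this, map_zero]⟩
      add_mem' := by
        rintro _ _ ⟨θ, rfl⟩ ⟨θ', rfl⟩
        refine ⟨θ + θ', ?_⟩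
        rw [← map_add]
        congr 1
        ext u v
        simp only [algM, LinearMap.add_apply, LinearMap.mk₂_apply, LinearMap.smul_apply, smul_add,
          add_smul]
        abel
      smul_mem' := by
        rintro c _ ⟨θ, rfl⟩
        refine ⟨c • θ, ?_⟩
        rw [← map_smul]
        congr 1
        ext u v
        simp only [algM, LinearMap.mk₂_apply, LinearMap.smul_apply, smul_add, smul_smul,
          smul_eq_mul, mul_left_comm c, mul_assoc] }
  apply_mem_toSubmodule := by
    rintro g _ ⟨θ, rfl⟩
    refine ⟨θ ∘ₗ (unop g).toLinearMap, (Θ b).symm.injective ?_⟩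
    ext u v
    rw [Θ_symm_repΛ]
    simp [algM]

/-- `𝓜**`: `[v, v]` lies in the span of `v`, for all `v`. -/
def subMstarstar (b : Module.Basis (Fin n) F V) : Subrepresentation (repΛ b) where
  toSubmodule :=
    { carrier := {l | ∀ v, (Θ b).symm l v v ∈ Submodule.span F {v}}
      zero_mem' := by simp
      add_mem' := fun hx hy v => by
        simpa using Submodule.add_mem _ (hx v) (hy v)
      smul_mem' := fun c x hx v => by
        simpa using Submodule.smul_mem _ c (hx v) }
  apply_mem_toSubmodule g l hl v := by
    rw [Θ_symm_repΛ]
    obtain ⟨c, hc⟩ := Submodule.mem_span_singleton.1 (hl (unop g v))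
    exact Submodule.mem_span_singleton.2 ⟨c, by rw [← hc]; simp⟩

end AlgStr

end

/-!
The submodules of `𝒞` are found by looking for highest weight vectors.  Submodules of `Λ` are
handled as `GL(V)`-invariant subspaces `P` of the space of products on `V`.

Let `φ` be a functional and `w` a vector with `φ(w) = 0`.  The transvections `v ↦ v + t φ(v) w` act
on a commutative product `[ , ]` through a cubic polynomial in `t`, whose `t²`-coefficient is
`φ² ⊗ [w, w] - φ · φ([w, -]) ⊗ w`.  As `|F| > 2`, this coefficient stays in `P`
(`IsInvariant.sq_coeff_mem`): take `t = ±1` if `2 ≠ 0`, and `t, 1, 1 + t` in characteristic 2.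

* If `φ([w, w]) ≠ 0`, another transvection produces `φ² ⊗ w' ∈ P` with `φ(w') = 0`
  (`IsInvariant.exists_rankOne_mem`).  `GL(V)` permutes these elements transitively and they span
  `𝒩`, so `𝒩 ≤ P` (`mem_of_rankOne_mem`).
* Otherwise `[w, w] ∈ Fw` for all products in `P` and all `w`.  In characteristic different from 2,
  polarisation gives `P ≤ 𝓜*_{(1,1)}`.  In characteristic 2, `w ↦ [w, w]` is additive and
  Frobenius-semilinear, and a semilinear map with this property is zero, so `P ≤ 𝒦`.
* If `P ≤ 𝒦` in characteristic 2, the same coefficient is `φ · φ([w, -]) ⊗ w`.  Either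
  `φ([w, -])` is independent of `φ` for some choice of product, `φ` and `w`, and the transitivity of
  `GL(V)` gives a set spanning `𝒰`, so `𝒰 ≤ P` (`mem_of_symOne_mem`); or `[u, v] ∈ Fu + Fv`
  throughout `P`, which forces `P ≤ 𝓜*_{(1,1)}`.

Finally `𝓜*_{(1,1)}` is isomorphic to the dual space, and so are `𝒞 / 𝒩` and `𝒦 / 𝒰`, by the adjoint
trace form.  The dual space is irreducible, so there is nothing below `𝓜*_{(1,1)}`, between `𝒩` and
`𝒞`, or between `𝒰` and `𝒦`.  Hence `𝒞` has the submodules `0, 𝓜*_{(1,1)}, 𝒩, 𝒞`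
(`eq_of_le_subC_of_two_ne_zero`), and in characteristic 2 also `𝒰` and `𝒦`
(`eq_of_le_subC_of_charTwo`).  The adjoint trace form of `𝔪_{θ,θ}` is `(n + 1) θ`, so `𝓜*_{(1,1)}`
lies in `𝒩` exactly when the characteristic divides `n + 1`.  Everything else is read off from
these small lattices.
-/

noncomputable section

namespace AlgStr

/-! ### Transitivity of the general linear group -/

section Transitivity

variable {F V : Type*} [Field F] [AddCommGroup V] [Module F V]

/-- `GL(W)` is transitive on linearly independent families of a given finite length. -/
theorem exists_linearEquiv_apply_eq {W ι : Type*} [AddCommGroup W] [Module F W]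
    [FiniteDimensional F W] {f f' : ι → W} (hf : LinearIndependent F f)
    (hf' : LinearIndependent F f') : ∃ h : W ≃ₗ[F] W, ∀ i, h (f i) = f' i := by
  obtain ⟨h, hh⟩ := Submodule.exists_linearEquiv_restrict_eq
    (hf.linearCombinationEquiv.symm ≪≫ₗ hf'.linearCombinationEquiv)
  refine ⟨h, fun i => ?_⟩
  have h1 : (hf.linearCombinationEquiv (Finsupp.single i 1) : W) = f i := by simp
  rw [← h1, ← hh]
  simp

/-- `GL(V)` is transitive on linearly independent families of functionals. -/
theorem exists_linearEquiv_comp_eq [FiniteDimensional F V] {ι : Type*}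
    {f f' : ι → Module.Dual F V} (hf : LinearIndependent F f) (hf' : LinearIndependent F f') :
    ∃ g : V ≃ₗ[F] V, ∀ i, f i ∘ₗ g.toLinearMap = f' i := by
  obtain ⟨h, hh⟩ := exists_linearEquiv_apply_eq hf hf'
  refine ⟨Module.evalEquiv F V ≪≫ₗ h.dualMap ≪≫ₗ (Module.evalEquiv F V).symm, fun i => ?_⟩
  ext v
  simp [Module.apply_evalEquiv_symm_apply, hh]

/-- Adjoining a functional that is nonzero at a common zero keeps a family independent. -/
theorem linearIndependent_cons_of_apply_eq_one {k : ℕ} {f : Fin k → Module.Dual F V}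
    (hf : LinearIndependent F f) {w : V} (hfw : ∀ i, f i w = 0) {χ : Module.Dual F V}
    (hχ : χ w = 1) : LinearIndependent F (Fin.cons χ f : Fin (k + 1) → Module.Dual F V) := by
  refine linearIndependent_finCons.2 ⟨hf, fun hmem => ?_⟩
  have hle : Submodule.span F (Set.range f) ≤ LinearMap.ker (Module.Dual.eval F V w) := by
    rw [Submodule.span_le]
    rintro _ ⟨i, rfl⟩
    simp [hfw]
  have := hle hmem
  simp [hχ] at this

/-- A vector outside a subspace is separated from it by a functional. -/
theorem exists_dual_eq_one_of_notMem {p : Submodule F V} {v : V} (hv : v ∉ p) :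
    ∃ χ : Module.Dual F V, χ v = 1 ∧ ∀ x ∈ p, χ x = 0 := by
  obtain ⟨f, hf, hp⟩ := Submodule.exists_le_ker_of_notMem hv
  refine ⟨(f v)⁻¹ • f, by simp [hf], fun x hx => ?_⟩
  have : f x = 0 := hp hx
  simp [this]

theorem exists_dual_eq_one_of_ne_zero {v : V} (hv : v ≠ 0) :
    ∃ χ : Module.Dual F V, χ v = 1 := by
  obtain ⟨χ, hχ, -⟩ := exists_dual_eq_one_of_notMem (F := F) (p := ⊥) (by simpa using hv)
  exact ⟨χ, hχ⟩

/-- `GL(V)` is transitive on pairs consisting of a linearly independent family of functionals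
and a nonzero common zero of it. -/
theorem exists_linearEquiv_comp_eq_symm_apply_eq [FiniteDimensional F V] {k : ℕ}
    {f f' : Fin k → Module.Dual F V} (hf : LinearIndependent F f) (hf' : LinearIndependent F f')
    {w w' : V} (hw : w ≠ 0) (hw' : w' ≠ 0) (hfw : ∀ i, f i w = 0) (hfw' : ∀ i, f' i w' = 0) :
    ∃ g : V ≃ₗ[F] V, (∀ i, f i ∘ₗ g.toLinearMap = f' i) ∧ g.symm w = w' := by
  obtain ⟨χ, hχ⟩ := exists_dual_eq_one_of_ne_zero (F := F) hw
  obtain ⟨χ', hχ'⟩ := exists_dual_eq_one_of_ne_zero (F := F) hw'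
  obtain ⟨g₁, hg₁⟩ := exists_linearEquiv_comp_eq
    (linearIndependent_cons_of_apply_eq_one hf hfw hχ)
    (linearIndependent_cons_of_apply_eq_one hf' hfw' hχ')
  have h₁ : ∀ i, f i ∘ₗ g₁.toLinearMap = f' i := fun i => by simpa using hg₁ i.succ
  have hχ₁ : χ ∘ₗ g₁.toLinearMap = χ' := by simpa using hg₁ 0
  -- `g₁` matches the functionals; a transvection fixing them then moves `g₁⁻¹ w` to `w'`.
  have hy : χ' (g₁.symm w - w') = 0 := by
    rw [map_sub, hχ', ← hχ₁]
    simp [hχ]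
  refine ⟨LinearEquiv.transvection hy ≪≫ₗ g₁, fun i => ?_, ?_⟩
  · ext v
    have hi' := fun v => LinearMap.congr_fun (h₁ i) v
    simp only [LinearMap.comp_apply, LinearEquiv.coe_coe] at hi'
    simp [LinearMap.transvection.apply, hi', hfw', hfw]
  · rw [LinearEquiv.trans_symm, LinearEquiv.trans_apply, LinearEquiv.symm_apply_eq,
      LinearEquiv.transvection.apply]
    simp [hχ']

theorem linearIndependent_pair_or_exists_eq_smul {φ ψ : Module.Dual F V} (hφ : φ ≠ 0) :
    LinearIndependent F ![φ, ψ] ∨ ∃ c : F, ψ = c • φ := by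
  by_cases h : ∃ c : F, c • φ = ψ
  · exact Or.inr (h.imp fun c hc => hc.symm)
  · exact Or.inl ((LinearIndependent.pair_iff' hφ).2 (not_exists.1 h))

theorem linearIndependent_const {χ : Module.Dual F V} (hχ : χ ≠ 0) :
    LinearIndependent F (fun _ : Fin 1 => χ) :=
  LinearIndependent.of_subsingleton (0 : Fin 1) hχ

/-- The dual space is an irreducible `GL(V)`-module. -/
theorem dual_eq_bot_or_eq_top [FiniteDimensional F V] (R : Submodule F (Module.Dual F V))
    (hR : ∀ g : V ≃ₗ[F] V, ∀ φ ∈ R, φ ∘ₗ g.toLinearMap ∈ R) : R = ⊥ ∨ R = ⊤ := by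
  refine or_iff_not_imp_left.2 fun h => ?_
  obtain ⟨φ, hφ, hφ0⟩ := Submodule.exists_mem_ne_zero_of_ne_bot h
  refine eq_top_iff.2 fun ψ _ => ?_
  by_cases hψ : ψ = 0
  · simp [hψ]
  obtain ⟨g, hg⟩ := exists_linearEquiv_comp_eq (linearIndependent_const hφ0)
    (linearIndependent_const hψ)
  rw [← hg 0]
  exact hR g φ hφ

end Transitivity

/-! ### Rank one products and transvections -/

section Products

variable {F V : Type*} [Field F] [AddCommGroup V] [Module F V]

/-- The product `[u, v] = φ(u) ψ(v) w`. -/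
def rankOne (φ ψ : Module.Dual F V) (w : V) : Alg F V := φ.smulRight (ψ.smulRight w)

@[simp]
theorem rankOne_apply (φ ψ : Module.Dual F V) (w u v : V) :
    rankOne φ ψ w u v = φ u • ψ v • w := rfl

/-- The product `[u, v] = (φ(u) ψ(v) + ψ(u) φ(v)) w`. -/
def symOne (φ ψ : Module.Dual F V) (w : V) : Alg F V := rankOne φ ψ w + rankOne ψ φ w

@[simp]
theorem symOne_apply (φ ψ : Module.Dual F V) (w u v : V) :
    symOne φ ψ w u v = φ u • ψ v • w + ψ u • φ v • w := rfl

@[simp]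
theorem algAct_apply (g : V ≃ₗ[F] V) (𝔤 : Alg F V) (u v : V) :
    algAct g 𝔤 u v = g.symm (𝔤 (g u) (g v)) := rfl

theorem algAct_rankOne (g : V ≃ₗ[F] V) (φ ψ : Module.Dual F V) (w : V) :
    algAct g (rankOne φ ψ w) =
      rankOne (φ ∘ₗ g.toLinearMap) (ψ ∘ₗ g.toLinearMap) (g.symm w) := by
  ext u v; simp

theorem algAct_symOne (g : V ≃ₗ[F] V) (φ ψ : Module.Dual F V) (w : V) :
    algAct g (symOne φ ψ w) =
      symOne (φ ∘ₗ g.toLinearMap) (ψ ∘ₗ g.toLinearMap) (g.symm w) := by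
  ext u v; simp

/-- A subspace of algebras is invariant if it is stable under the action of `GL(V)`. -/
def IsInvariant (P : Submodule F (Alg F V)) : Prop :=
  ∀ g : V ≃ₗ[F] V, ∀ 𝔤 ∈ P, algAct g 𝔤 ∈ P

variable {P : Submodule F (Alg F V)}

/-- An invariant subspace that contains one square `φ² ⊗ w`, with `φ(w) = 0` and `φ, w` nonzero,
contains all of them. -/
theorem IsInvariant.rankOne_mem [FiniteDimensional F V] (hP : IsInvariant P)
    {φ φ' : Module.Dual F V} {w w' : V} (hφ : φ ≠ 0) (hw : w ≠ 0) (h : φ w = 0)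
    (hmem : rankOne φ φ w ∈ P) (h' : φ' w' = 0) : rankOne φ' φ' w' ∈ P := by
  by_cases hφ' : φ' = 0
  · have : rankOne φ' φ' w' = 0 := by ext; simp [hφ']
    simp [this]
  by_cases hw' : w' = 0
  · have : rankOne φ' φ' w' = 0 := by ext; simp [hw']
    simp [this]
  obtain ⟨g, hg, hgw⟩ := exists_linearEquiv_comp_eq_symm_apply_eq (linearIndependent_const hφ)
    (linearIndependent_const hφ') hw hw' (fun _ => h) (fun _ => h')
  have := hP g _ hmem
  rwa [algAct_rankOne, hg 0, hgw] at this

/-- An invariant subspace that contains one product `φψ ⊗ w`, with `φ, ψ` independent and zero at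
`w ≠ 0`, contains all of them. -/
theorem IsInvariant.symOne_mem [FiniteDimensional F V] (hP : IsInvariant P)
    {φ ψ φ' ψ' : Module.Dual F V} {w w' : V} (hli : LinearIndependent F ![φ, ψ]) (hw : w ≠ 0)
    (hφ : φ w = 0) (hψ : ψ w = 0) (hmem : symOne φ ψ w ∈ P)
    (hli' : LinearIndependent F ![φ', ψ']) (hφ' : φ' w' = 0) (hψ' : ψ' w' = 0) :
    symOne φ' ψ' w' ∈ P := by
  by_cases hw' : w' = 0
  · have : symOne φ' ψ' w' = 0 := by ext; simp [hw']
    simp [this]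
  obtain ⟨g, hg, hgw⟩ := exists_linearEquiv_comp_eq_symm_apply_eq hli hli' hw hw'
    (by simp [Fin.forall_fin_two, hφ, hψ]) (by simp [Fin.forall_fin_two, hφ', hψ'])
  have := hP g _ hmem
  have h0 := hg 0
  have h1 := hg 1
  simp only [Matrix.cons_val_zero, Matrix.cons_val_one] at h0 h1
  rwa [algAct_symOne, h0, h1, hgw] at this

theorem transvection_symm_apply {φ : Module.Dual F V} {w : V} (h : φ w = 0) (y : V) :
    (LinearEquiv.transvection h).symm y = y - φ y • w := by
  rw [LinearEquiv.symm_apply_eq, LinearEquiv.transvection.apply]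
  simp [h]

/-- The action of the transvection `v ↦ v + t φ(v) w` on a commutative algebra, as a polynomial
in `t`. -/
theorem algAct_transvection {𝔤 : Alg F V} (hc : ∀ u v, 𝔤 u v = 𝔤 v u) {φ : Module.Dual F V}
    {w : V} (t : F) (h : φ (t • w) = 0) :
    algAct (LinearEquiv.transvection h) 𝔤 = 𝔤
      + t • (φ.smulRight (𝔤 w) + (φ.smulRight (𝔤 w)).flip
          - 𝔤.compr₂ (φ.smulRight w))
      + t ^ 2 • (rankOne φ φ (𝔤 w w) - symOne φ (φ ∘ₗ 𝔤 w) w)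
      - t ^ 3 • φ (𝔤 w w) • rankOne φ φ w := by
  ext u v
  rw [algAct_apply, transvection_symm_apply]
  simp only [LinearEquiv.transvection.apply, map_add, map_smul, LinearMap.add_apply,
    LinearMap.smul_apply, LinearMap.sub_apply, LinearMap.smulRight_apply, LinearMap.flip_apply,
    LinearMap.compr₂_apply, rankOne_apply, symOne_apply, LinearMap.comp_apply, smul_eq_mul,
    hc u w]
  module

/-- The coefficient of `t²` in the action of the transvections `v ↦ v + t φ(v) w` on a
commutative algebra stays in every invariant subspace that contains the algebra. -/
theorem IsInvariant.sq_coeff_mem (hP : IsInvariant P) (hF : ∃ t : F, t ≠ 0 ∧ t ≠ 1)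
    {𝔤 : Alg F V} (h𝔤 : 𝔤 ∈ P) (hc : ∀ u v, 𝔤 u v = 𝔤 v u) {φ : Module.Dual F V} {w : V}
    (h : φ w = 0) : rankOne φ φ (𝔤 w w) - symOne φ (φ ∘ₗ 𝔤 w) w ∈ P := by
  have key : ∀ t : F, algAct (LinearEquiv.transvection (f := φ) (v := t • w) (by simp [h])) 𝔤 ∈ P :=
    fun t => hP _ _ h𝔤
  simp only [algAct_transvection hc] at key
  generalize φ.smulRight (𝔤 w) + (φ.smulRight (𝔤 w)).flip - 𝔤.compr₂ (φ.smulRight w) = A at key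
  generalize rankOne φ φ (𝔤 w w) - symOne φ (φ ∘ₗ 𝔤 w) w = B at key ⊢
  generalize φ (𝔤 w w) • rankOne φ φ w = C at key
  have key' : ∀ t : F, t • A + t ^ 2 • B - t ^ 3 • C ∈ P := fun t => by
    have := P.sub_mem (key t) h𝔤
    convert this using 1
    module
  by_cases h2 : (2 : F) = 0
  · obtain ⟨t, h0, h1⟩ := hF
    have h1' : t - 1 ≠ 0 := sub_ne_zero.2 h1
    -- in characteristic 2, `t ↦ t A + t² B` is additive, so that `t = 1, t, 1 + t` isolate `C`
    have hC : (t * (t + 1)) • C ∈ P := by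
      have := P.sub_mem (P.add_mem (key' t) (key' 1)) (key' (1 + t))
      convert this using 1
      have hB0 : (2 : F) • t • B = 0 := by rw [h2, zero_smul]
      have hC0 : (2 : F) • (t + t ^ 2) • C = 0 := by rw [h2, zero_smul]
      linear_combination (norm := module) hB0 - hC0
    have ht : t + 1 = t - 1 := by linear_combination h2
    rw [ht, Submodule.smul_mem_iff _ (mul_ne_zero h0 h1')] at hC
    have hB : (t * (t - 1)) • B ∈ P := by
      have := P.add_mem (P.sub_mem (key' t) (P.smul_mem t (key' 1)))
        (P.smul_mem (t ^ 3 - t) hC)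
      convert this using 1
      module
    exact (Submodule.smul_mem_iff _ (mul_ne_zero h0 h1')).1 hB
  · have : (2 : F) • B ∈ P := by
      convert P.add_mem (key' 1) (key' (-1)) using 1
      module
    exact (Submodule.smul_mem_iff _ h2).1 this

/-- If `[w, w]` is not in the kernel of a functional `φ` with `φ(w) = 0`, then a second
transvection turns the `t²`-coefficient into some `φ² ⊗ w'`. -/
theorem IsInvariant.exists_rankOne_mem [FiniteDimensional F V] (hP : IsInvariant P)
    (hV : 3 ≤ Module.finrank F V) (hF : ∃ t : F, t ≠ 0 ∧ t ≠ 1)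
    {𝔤 : Alg F V} (h𝔤 : 𝔤 ∈ P) (hc : ∀ u v, 𝔤 u v = 𝔤 v u) {φ : Module.Dual F V} {w : V}
    (h : φ w = 0) (hne : φ (𝔤 w w) ≠ 0) : ∃ w', w' ≠ 0 ∧ φ w' = 0 ∧ rankOne φ φ w' ∈ P := by
  have hB := hP.sq_coeff_mem hF h𝔤 hc h
  set x := 𝔤 w w
  set β := φ ∘ₗ 𝔤 w
  -- the transvection `v ↦ v + ψ(v) w'` fixes `φ`, `β` and `w`, and moves `x` to `x - w'`
  obtain ⟨w', hw', hw'0⟩ := Submodule.exists_mem_ne_zero_of_ne_bot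
    (LinearMap.ker_ne_bot_of_finrank_lt (f := φ.prod β) (by simp; omega))
  obtain ⟨h1, h2⟩ : φ w' = 0 ∧ β w' = 0 := by simpa using hw'
  obtain ⟨ψ, hψx, hψ⟩ := exists_dual_eq_one_of_notMem (p := Submodule.span F {w, w'}) (v := x)
    (F := F) fun hx => by
      obtain ⟨a, b, hab⟩ := Submodule.mem_span_pair.1 hx
      exact hne (by rw [← hab]; simp [h, h1])
  have hψw : ψ w = 0 := hψ _ (Submodule.subset_span (by simp))
  have hψw' : ψ w' = 0 := hψ _ (Submodule.subset_span (by simp))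
  refine ⟨w', hw'0, h1, ?_⟩
  have := P.sub_mem hB (hP (LinearEquiv.transvection hψw') _ hB)
  convert this using 1
  ext u v
  simp only [LinearMap.sub_apply, algAct_apply, transvection_symm_apply]
  simp only [LinearEquiv.transvection.apply, map_add, map_smul, map_sub, LinearMap.add_apply,
    LinearMap.smul_apply, rankOne_apply, symOne_apply, smul_eq_mul, h1, h2, hψw, hψx]
  module

end Products

/-! ### Spanning sets of traceless products -/

section Spanning

variable {F V : Type*} [Field F] [AddCommGroup V] [Module F V] {n : ℕ}

theorem trace_eq_sum_repr (b : Module.Basis (Fin n) F V) (f : V →ₗ[F] V) :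
    LinearMap.trace F V f = ∑ j, b.repr (f (b j)) j := by
  simp [LinearMap.trace_eq_matrix_trace F b, Matrix.trace, LinearMap.toMatrix_apply]

theorem trace_rankOne (b : Module.Basis (Fin n) F V) (φ ψ : Module.Dual F V) (w u : V) :
    LinearMap.trace F V (rankOne φ ψ w u) = φ u * ψ w := by
  have := Module.Finite.of_basis b
  have h : rankOne φ ψ w u = φ u • ψ.smulRight w := rfl
  rw [h, map_smul, LinearMap.trace_smulRight, smul_eq_mul]

theorem trace_symOne (b : Module.Basis (Fin n) F V) (φ ψ : Module.Dual F V) (w u : V) :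
    LinearMap.trace F V (symOne φ ψ w u) = φ u * ψ w + ψ u * φ w := by
  rw [symOne, LinearMap.add_apply, map_add, trace_rankOne b, trace_rankOne b]

theorem coord_ne_zero (b : Module.Basis (Fin n) F V) (i : Fin n) : b.coord i ≠ 0 := fun h => by
  simpa using LinearMap.congr_fun h (b i)

theorem linearIndependent_coord_pair (b : Module.Basis (Fin n) F V) {i j : Fin n} (h : i ≠ j) :
    LinearIndependent F ![b.coord i, b.coord j] := by
  refine LinearIndependent.pair_iff.2 fun s t hst => ⟨?_, ?_⟩
  · simpa [h, h.symm] using LinearMap.congr_fun hst (b i)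
  · simpa [h, h.symm] using LinearMap.congr_fun hst (b j)

/-- A commutative product that vanishes on the diagonal of a basis is a combination of the products
`(eᵢ eⱼ) ⊗ [bᵢ, bⱼ]` with `i < j`. -/
theorem eq_sum_symOne (b : Module.Basis (Fin n) F V) {𝔤 : Alg F V} (hc : ∀ u v, 𝔤 u v = 𝔤 v u)
    (hd : ∀ i, 𝔤 (b i) (b i) = 0) :
    𝔤 = ∑ i, ∑ j, if i < j then symOne (b.coord i) (b.coord j) (𝔤 (b i) (b j)) else 0 := by
  refine b.ext fun k => b.ext fun l => ?_
  have key : ∀ i j, (if i < j then symOne (b.coord i) (b.coord j) (𝔤 (b i) (b j)) else 0)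
      (b k) (b l) = (if i = k then if j = l then if k < l then 𝔤 (b k) (b l) else 0 else 0 else 0)
        + (if i = l then if j = k then if l < k then 𝔤 (b k) (b l) else 0 else 0 else 0) := by
    intro i j
    split_ifs with h1 <;> subst_vars <;>
      simp_all [Finsupp.single_apply, eq_comm]
  simp only [LinearMap.sum_apply, key, Finset.sum_add_distrib, Finset.sum_ite_eq',
    Finset.mem_univ, if_true, Finset.sum_ite_irrel, Finset.sum_const_zero]
  rcases lt_trichotomy k l with h | rfl | h
  · simp [h, h.le.not_gt]
  · simp [hd]
  · simp [h, h.le.not_gt]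

variable {P : Submodule F (Alg F V)}

/-- If `P` contains all `φψ ⊗ w` with `φ, ψ` independent and zero at `w`, it contains every
commutative product that vanishes on the diagonal of a basis and has zero adjoint traces. -/
theorem mem_of_symOne_mem (b : Module.Basis (Fin n) F V)
    (H : ∀ φ ψ w, LinearIndependent F ![φ, ψ] → φ w = 0 → ψ w = 0 → symOne φ ψ w ∈ P)
    {𝔤 : Alg F V} (hc : ∀ u v, 𝔤 u v = 𝔤 v u) (hd : ∀ i, 𝔤 (b i) (b i) = 0)
    (ht : ∀ u, LinearMap.trace F V (𝔤 u) = 0) : 𝔤 ∈ P := by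
  -- modulo `P`, the product `eᵢ eⱼ ⊗ bⱼ` does not depend on `j ≠ i`
  have h2 : ∀ i j k, i ≠ j → i ≠ k →
      P.mkQ (symOne (b.coord i) (b.coord j) (b j)) =
        P.mkQ (symOne (b.coord i) (b.coord k) (b k)) := by
    intro i j k hij hik
    rcases eq_or_ne j k with rfl | hjk
    · rfl
    rw [← sub_eq_zero, ← map_sub, Submodule.mkQ_apply, Submodule.Quotient.mk_eq_zero]
    have m1 := H (b.coord i) (b.coord j + b.coord k) (b j - b k)
      (by
        refine LinearIndependent.pair_iff.2 fun s t hst => ⟨?_, ?_⟩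
        · simpa [hij, hij.symm, hik, hik.symm] using LinearMap.congr_fun hst (b i)
        · simpa [hij, hij.symm, hjk, hjk.symm] using LinearMap.congr_fun hst (b j))
      (by simp [hij, hik]) (by simp [hjk, hjk.symm])
    have m2 := H (b.coord i) (b.coord j) (b k) (linearIndependent_coord_pair b hij)
      (by simp [hik]) (by simp [hjk])
    have m3 := H (b.coord i) (b.coord k) (b j) (linearIndependent_coord_pair b hik)
      (by simp [hij]) (by simp [hjk.symm])
    convert P.sub_mem (P.add_mem m1 m2) m3 using 1
    ext u v
    simp only [LinearMap.sub_apply, LinearMap.add_apply, symOne_apply]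
    module
  have hX : ∀ i, ∃ X, ∀ j, i ≠ j → P.mkQ (symOne (b.coord i) (b.coord j) (b j)) = X := fun i => by
    by_cases h : ∃ j, i ≠ j
    · obtain ⟨j, hj⟩ := h
      exact ⟨_, fun k hk => h2 i k j hk hj⟩
    · exact ⟨0, fun j hj => (h ⟨j, hj⟩).elim⟩
  choose X hX using hX
  have h3 : ∀ i j x, i ≠ j → P.mkQ (symOne (b.coord i) (b.coord j) x) =
      b.repr x i • X j + b.repr x j • X i := by
    intro i j x hij
    rw [← hX i j hij, ← hX j i hij.symm, ← map_smul, ← map_smul, ← map_add, ← sub_eq_zero,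
      ← map_sub, Submodule.mkQ_apply, Submodule.Quotient.mk_eq_zero]
    convert H (b.coord i) (b.coord j) (x - b.repr x i • b i - b.repr x j • b j)
      (linearIndependent_coord_pair b hij) (by simp [hij]) (by simp [hij.symm])
      using 1
    ext u v
    simp only [LinearMap.sub_apply, LinearMap.add_apply, LinearMap.smul_apply, symOne_apply]
    module
  rw [← Submodule.Quotient.mk_eq_zero, ← Submodule.mkQ_apply]
  have h4 : P.mkQ 𝔤 = ∑ i, ∑ j, if i < j then
      b.repr (𝔤 (b i) (b j)) i • X j + b.repr (𝔤 (b i) (b j)) j • X i else 0 := by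
    conv_lhs => rw [eq_sum_symOne b hc hd]
    simp only [map_sum]
    refine Finset.sum_congr rfl fun i _ => Finset.sum_congr rfl fun j _ => ?_
    split_ifs with h
    · exact h3 i j _ h.ne
    · simp
  have h5 : (∑ i, ∑ j, if i < j then b.repr (𝔤 (b i) (b j)) i • X j else 0) =
      ∑ i, ∑ j, if j < i then b.repr (𝔤 (b i) (b j)) j • X i else 0 := by
    rw [Finset.sum_comm]
    refine Finset.sum_congr rfl fun i _ => Finset.sum_congr rfl fun j _ => ?_
    rw [hc]
  simp only [ite_add_zero, Finset.sum_add_distrib] at h4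
  rw [h4, h5, ← Finset.sum_add_distrib]
  refine Finset.sum_eq_zero fun i _ => ?_
  have h6 := ht (b i)
  rw [trace_eq_sum_repr b] at h6
  rw [← Finset.sum_add_distrib]
  refine Eq.trans ?_ (by rw [← Finset.sum_smul, h6, zero_smul] :
    ∑ j, b.repr (𝔤 (b i) (b j)) j • X i = 0)
  refine Finset.sum_congr rfl fun j _ => ?_
  rcases lt_trichotomy i j with h | rfl | h
  · simp [h, h.le.not_gt]
  · simp [hd]
  · simp [h, h.le.not_gt]

/-- If `P` contains all `φ² ⊗ w` with `φ(w) = 0`, it contains every commutative product with zero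
adjoint traces. -/
theorem mem_of_rankOne_mem (hn : 2 ≤ n) (hF : ∃ t : F, t ≠ 0 ∧ t ≠ 1)
    (b : Module.Basis (Fin n) F V)
    (H : ∀ φ w, φ w = 0 → rankOne φ φ w ∈ P) {𝔤 : Alg F V} (hc : ∀ u v, 𝔤 u v = 𝔤 v u)
    (ht : ∀ u, LinearMap.trace F V (𝔤 u) = 0) : 𝔤 ∈ P := by
  have H2 : ∀ φ ψ w, φ w = 0 → ψ w = 0 → symOne φ ψ w ∈ P := by
    intro φ ψ w hφ hψ
    have := P.sub_mem (P.sub_mem (H (φ + ψ) w (by simp [hφ, hψ])) (H φ w hφ)) (H ψ w hψ)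
    convert this using 1
    ext u v
    simp only [LinearMap.sub_apply, LinearMap.add_apply, symOne_apply, rankOne_apply]
    module
  -- polarising `(eᵢ + t eⱼ)² ⊗ (t bᵢ - bⱼ)` in `t`
  have H3 : ∀ i j, i ≠ j →
      rankOne (b.coord i) (b.coord i) (b i) - symOne (b.coord i) (b.coord j) (b j) ∈ P := by
    intro i j hij
    have m1 := H (b.coord i) (b j) (by simp [hij])
    have m2 := H (b.coord j) (b i) (by simp [hij.symm])
    have m3 : ∀ t : F, t • (rankOne (b.coord i) (b.coord i) (b i)
        - symOne (b.coord i) (b.coord j) (b j)) - t ^ 2 • (rankOne (b.coord j) (b.coord j) (b j)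
        - symOne (b.coord i) (b.coord j) (b i)) ∈ P := by
      intro t
      have := H (b.coord i + t • b.coord j) (t • b i - b j) (by simp [hij, hij.symm])
      convert P.sub_mem (P.add_mem this m1) (P.smul_mem (t ^ 3) m2) using 1
      ext u v
      simp only [LinearMap.sub_apply, LinearMap.add_apply, symOne_apply, rankOne_apply,
        LinearMap.smul_apply, smul_eq_mul]
      module
    obtain ⟨t, h0, h1⟩ := hF
    have h1' : 1 - t ≠ 0 := sub_ne_zero.2 h1.symm
    rw [← Submodule.smul_mem_iff _ (mul_ne_zero h0 h1')]
    convert P.sub_mem (m3 t) (P.smul_mem (t ^ 2) (m3 1)) using 1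
    module
  have hs : ∀ i : Fin n, ∃ j, i ≠ j := fun i => by
    have : Nontrivial (Fin n) := Fin.nontrivial_iff_two_le.2 hn
    obtain ⟨j, hj⟩ := exists_ne i
    exact ⟨j, hj.symm⟩
  choose s hs using hs
  set D : Fin n → Alg F V := fun i => rankOne (b.coord i) (b.coord i) (𝔤 (b i) (b i))
    - b.repr (𝔤 (b i) (b i)) i • symOne (b.coord i) (b.coord (s i)) (b (s i)) with hD
  have hDmem : ∀ i, D i ∈ P := fun i => by
    have m1 := H (b.coord i) (𝔤 (b i) (b i) - b.repr (𝔤 (b i) (b i)) i • b i) (by simp)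
    convert P.add_mem m1 (P.smul_mem (b.repr (𝔤 (b i) (b i)) i) (H3 i (s i) (hs i))) using 1
    ext u v
    simp only [hD, LinearMap.sub_apply, LinearMap.add_apply, symOne_apply, rankOne_apply,
        LinearMap.smul_apply]
    module
  have hDsum : ∑ i, D i ∈ P := P.sum_mem fun i _ => hDmem i
  -- removing the part on the diagonal leaves a product covered by the off-diagonal case
  have hmem : 𝔤 - ∑ i, D i ∈ P := by
    refine mem_of_symOne_mem b (fun φ ψ w _ => H2 φ ψ w) (fun u v => ?_) (fun k => ?_) fun u => ?_
    · simp only [LinearMap.sub_apply, LinearMap.sum_apply, hc u v, hD, symOne_apply,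
        rankOne_apply, LinearMap.smul_apply]
      congr 1
      refine Finset.sum_congr rfl fun i _ => ?_
      module
    · have key : ∀ i, D i (b k) (b k) = if i = k then 𝔤 (b k) (b k) else 0 := fun i => by
        rcases eq_or_ne i k with rfl | h
        · simp [hD, (hs i).symm]
        · simp [hD, h]
      simp [LinearMap.sum_apply, key]
    · rw [LinearMap.sub_apply, map_sub, ht, LinearMap.sum_apply, map_sum, zero_sub, neg_eq_zero]
      refine Finset.sum_eq_zero fun i _ => ?_
      rw [hD, LinearMap.sub_apply, LinearMap.smul_apply, map_sub, map_smul, trace_rankOne b,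
        trace_symOne b]
      simp [hs i, mul_comm]
  simpa using P.add_mem hmem hDsum

end Spanning

/-! ### Invariant subspaces of commutative algebras -/

section Invariant

variable {F V : Type*} [Field F] [AddCommGroup V] [Module F V] {n : ℕ}
  {P : Submodule F (Alg F V)}

@[simp]
theorem algM_apply (α δ : Module.Dual F V) (u v : V) : algM α δ u v = α v • u + δ u • v := rfl

theorem algAct_algM (g : V ≃ₗ[F] V) (α δ : Module.Dual F V) :
    algAct g (algM α δ) = algM (α ∘ₗ g.toLinearMap) (δ ∘ₗ g.toLinearMap) := by
  ext u v; simp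

theorem trace_algM (b : Module.Basis (Fin n) F V) (θ : Module.Dual F V) (u : V) :
    LinearMap.trace F V (algM θ θ u) = (n + 1) * θ u := by
  have := Module.Finite.of_basis b
  have h : algM θ θ u = θ.smulRight u + θ u • LinearMap.id := by ext v; simp
  rw [h, map_add, map_smul, LinearMap.trace_smulRight, LinearMap.trace_id,
    Module.finrank_eq_card_basis b]
  simp
  ring

variable (F V) in
/-- The linear map `θ ↦ 𝔪_{θ,θ}`. -/
def algMLin : Module.Dual F V →ₗ[F] Alg F V where
  toFun θ := algM θ θ
  map_add' θ θ' := by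
    ext u v
    simp only [algM_apply, LinearMap.add_apply]
    module
  map_smul' c θ := by
    ext u v
    simp only [algM_apply, LinearMap.smul_apply, RingHom.id_apply, smul_eq_mul]
    module

variable (F V) in
/-- The adjoint trace form `u ↦ tr (v ↦ [u, v])`, as a linear function of the algebra. -/
def trForm : Alg F V →ₗ[F] Module.Dual F V where
  toFun 𝔤 := LinearMap.trace F V ∘ₗ 𝔤
  map_add' _ _ := by ext; simp
  map_smul' _ _ := by ext; simp

@[simp]
theorem trForm_apply (𝔤 : Alg F V) (u : V) : trForm F V 𝔤 u = LinearMap.trace F V (𝔤 u) := rfl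

theorem trForm_algAct (g : V ≃ₗ[F] V) (𝔤 : Alg F V) :
    trForm F V (algAct g 𝔤) = trForm F V 𝔤 ∘ₗ g.toLinearMap := by
  ext u
  have h : algAct g 𝔤 u = g.symm.conj (𝔤 (g u)) := by
    ext v
    simp [LinearEquiv.conj_apply]
  simp [h, LinearMap.trace_conj']

/-- The adjoint trace form of an invariant subspace is zero or onto the dual space. -/
theorem IsInvariant.trForm_eq_zero_or_surjective [FiniteDimensional F V] (hP : IsInvariant P) :
    (∀ 𝔤 ∈ P, trForm F V 𝔤 = 0) ∨ ∀ θ, ∃ 𝔤 ∈ P, trForm F V 𝔤 = θ := by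
  refine (dual_eq_bot_or_eq_top (P.map (trForm F V)) ?_).imp (fun h 𝔤 h𝔤 => ?_) fun h θ => ?_
  · rintro g _ ⟨𝔤, h𝔤, rfl⟩
    exact ⟨_, hP g 𝔤 h𝔤, trForm_algAct g 𝔤⟩
  · simpa [h] using Submodule.mem_map_of_mem (f := trForm F V) h𝔤
  · exact (h ▸ Submodule.mem_top : θ ∈ P.map (trForm F V))

/-- An invariant subspace meets `{𝔪_{θ,θ}}` trivially or contains it. -/
theorem IsInvariant.algM_notMem_or_mem [FiniteDimensional F V] (hP : IsInvariant P) :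
    (∀ θ : Module.Dual F V, algM θ θ ∈ P → θ = 0) ∨ ∀ θ : Module.Dual F V, algM θ θ ∈ P := by
  refine (dual_eq_bot_or_eq_top (P.comap (algMLin F V)) ?_).imp (fun h θ hθ => ?_) fun h θ => ?_
  · intro g φ hφ
    have := hP g (algM φ φ) hφ
    rw [algAct_algM] at this
    exact this
  · have : θ ∈ P.comap (algMLin F V) := hθ
    simpa [h] using this
  · exact (h ▸ Submodule.mem_top : θ ∈ P.comap (algMLin F V))

/-- An invariant subspace of commutative algebras contains all traceless ones, or else all its
squares `[v, v]` are multiples of `v`. -/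
theorem IsInvariant.traceless_mem_or_sq_mem_span (hn : 3 ≤ n) (hF : ∃ t : F, t ≠ 0 ∧ t ≠ 1)
    (b : Module.Basis (Fin n) F V) (hP : IsInvariant P)
    (hC : ∀ 𝔤 ∈ P, ∀ u v, 𝔤 u v = 𝔤 v u) :
    (∀ 𝔤 : Alg F V, (∀ u v, 𝔤 u v = 𝔤 v u) → trForm F V 𝔤 = 0 → 𝔤 ∈ P) ∨
      ∀ 𝔤 ∈ P, ∀ v, 𝔤 v v ∈ Submodule.span F {v} := by
  have := Module.Finite.of_basis b
  refine or_iff_not_imp_right.2 fun h 𝔥 h𝔥 htr => ?_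
  push Not at h
  obtain ⟨𝔤, h𝔤, v, hv⟩ := h
  obtain ⟨φ, hφ, hφv⟩ := exists_dual_eq_one_of_notMem hv
  obtain ⟨w, hw, hφw, hmem⟩ := hP.exists_rankOne_mem
    (by simpa [Module.finrank_eq_card_basis b] using hn) hF h𝔤 (hC 𝔤 h𝔤)
    (hφv v (Submodule.mem_span_singleton_self v)) (by simp [hφ])
  have hφ0 : φ ≠ 0 := by rintro rfl; simp at hφ
  exact mem_of_rankOne_mem (by omega) hF b (fun φ' w' h' => hP.rankOne_mem hφ0 hw hφw hmem h') h𝔥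
    (LinearMap.congr_fun htr)

/-- An invariant subspace of algebras that are both commutative and alternating contains all
traceless ones, or else all its products `[u, v]` lie in the span of `u` and `v`. -/
theorem IsInvariant.traceless_mem_or_mul_mem_span (hF : ∃ t : F, t ≠ 0 ∧ t ≠ 1)
    (b : Module.Basis (Fin n) F V) (hP : IsInvariant P)
    (hC : ∀ 𝔤 ∈ P, ∀ u v, 𝔤 u v = 𝔤 v u) (hK : ∀ 𝔤 ∈ P, ∀ v, 𝔤 v v = 0) :
    (∀ 𝔤 : Alg F V, (∀ u v, 𝔤 u v = 𝔤 v u) → (∀ v, 𝔤 v v = 0) → trForm F V 𝔤 = 0 → 𝔤 ∈ P) ∨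
      ∀ 𝔤 ∈ P, ∀ u v, 𝔤 u v ∈ Submodule.span F {u, v} := by
  have := Module.Finite.of_basis b
  refine or_iff_not_imp_right.2 fun h 𝔥 h𝔥 hd htr => ?_
  push Not at h
  obtain ⟨𝔤, h𝔤, w, v, hv⟩ := h
  obtain ⟨φ, hφ, hφv⟩ := exists_dual_eq_one_of_notMem hv
  have hφ0 : φ ≠ 0 := by rintro rfl; simp at hφ
  have h1 : φ w = 0 := hφv _ (Submodule.subset_span (by simp))
  have h2 : φ v = 0 := hφv _ (Submodule.subset_span (by simp))
  have hw : w ≠ 0 := by rintro rfl; simp at hφ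
  -- since `[w, w] = 0`, the `t²`-coefficient is the product `φ (φ ∘ ad w) ⊗ w`
  have hmem := hP.sq_coeff_mem hF h𝔤 (hC 𝔤 h𝔤) h1
  have h0 : rankOne φ φ (𝔤 w w) = 0 := by ext; simp [hK 𝔤 h𝔤]
  rw [h0, zero_sub, P.neg_mem_iff] at hmem
  have hli : LinearIndependent F ![φ, φ ∘ₗ 𝔤 w] := by
    refine (linearIndependent_pair_or_exists_eq_smul hφ0).resolve_right ?_
    rintro ⟨c, hc⟩
    have := LinearMap.congr_fun hc v
    simp [hφ, h2] at this
  exact mem_of_symOne_mem b (fun φ' ψ' w' hli' h1' h2' => hP.symOne_mem hli hw h1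
    (by simp [hK 𝔤 h𝔤]) hmem hli' h1' h2') h𝔥 (fun i => hd _) (LinearMap.congr_fun htr)

/-- In characteristic different from 2, a commutative algebra with `[v, v] ∈ Fv` for all `v` is
some `𝔪_{θ,θ}`. -/
theorem exists_eq_algM_of_sq_mem_span (h2 : (2 : F) ≠ 0) (b : Module.Basis (Fin n) F V)
    {𝔤 : Alg F V} (hc : ∀ u v, 𝔤 u v = 𝔤 v u) (h : ∀ v, 𝔤 v v ∈ Submodule.span F {v}) :
    ∃ θ : Module.Dual F V, 𝔤 = algM θ θ := by
  choose f hf using fun v => Submodule.mem_span_singleton.1 (h v)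
  refine ⟨b.constr F fun i => f (b i) / 2, b.ext fun i => b.ext fun j => ?_⟩
  rw [algM_apply, b.constr_basis, b.constr_basis]
  refine smul_right_injective V h2 ?_
  rcases eq_or_ne i j with rfl | hij
  · simp only [← hf, smul_add, smul_smul]
    rw [mul_div_cancel₀ _ h2]
    module
  have e1 := hf (b i + b j)
  have e2 := hf (b i - b j)
  simp only [map_add, map_sub, LinearMap.add_apply, LinearMap.sub_apply, hc (b j) (b i)] at e1 e2
  rw [← hf (b i), ← hf (b j)] at e1 e2
  set p := f (b i + b j)
  set q := f (b i - b j)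
  -- comparing coefficients in `[u + v, u + v] + [u - v, u - v] = 2 [u, u] + 2 [v, v]`
  have e3 : p • (b i + b j) + q • (b i - b j) =
      (2 * f (b i)) • b i + (2 * f (b j)) • b j := by
    rw [e1, e2]; module
  have ei := congrArg (fun x => b.repr x i) e3
  have ej := congrArg (fun x => b.repr x j) e3
  simp [hij, hij.symm] at ei ej
  have hp : p = f (b i) + f (b j) := by
    refine mul_left_cancel₀ h2 ?_
    linear_combination ei + ej
  rw [hp] at e1
  simp only [smul_add, smul_smul, mul_div_cancel₀ _ h2]
  linear_combination (norm := module) -e1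

/-- In characteristic 2, a commutative algebra with `[v, v] ∈ Fv` for all `v` is alternating:
`v ↦ [v, v]` is additive and Frobenius-semilinear. -/
theorem sq_eq_zero_of_sq_mem_span [CharP F 2] (hn : 2 ≤ n) (hF : ∃ t : F, t ≠ 0 ∧ t ≠ 1)
    (b : Module.Basis (Fin n) F V) {𝔤 : Alg F V} (hc : ∀ u v, 𝔤 u v = 𝔤 v u)
    (h : ∀ v, 𝔤 v v ∈ Submodule.span F {v}) (v : V) : 𝔤 v v = 0 := by
  have := Module.Finite.of_basis b
  obtain ⟨t, ht0, ht1⟩ := hF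
  rcases eq_or_ne v 0 with rfl | hv
  · simp
  choose f hf using fun v => Submodule.mem_span_singleton.1 (h v)
  have hind : ∀ x y, LinearIndependent F ![x, y] → f x = f y := by
    intro x y hxy
    have e := hf (x + y)
    simp only [map_add, LinearMap.add_apply, hc y x] at e
    have e2 : 𝔤 x y + 𝔤 x y = 0 := by
      rw [← two_smul F, CharTwo.two_eq_zero, zero_smul]
    rw [add_assoc, ← add_assoc (𝔤 x y), e2, zero_add, ← hf x, ← hf y] at e
    obtain ⟨h1, h2⟩ := LinearIndependent.pair_iff.1 hxy (f (x + y) - f x) (f (x + y) - f y)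
      (by linear_combination (norm := module) e)
    rw [← sub_eq_zero.1 h1, ← sub_eq_zero.1 h2]
  obtain ⟨u, hu⟩ := exists_linearIndependent_pair_of_one_lt_finrank (R := F)
    (by simpa [Module.finrank_eq_card_basis b] using (by omega : 1 < n)) hv
  have hu' : LinearIndependent F ![u, t • v] := by
    refine LinearIndependent.pair_iff.2 fun p q hpq => ?_
    have := LinearIndependent.pair_iff.1 hu (q * t) p (by rw [← hpq]; module)
    exact ⟨this.2, (mul_eq_zero.1 this.1).resolve_right ht0⟩
  have e1 : f v = f (t • v) := (hind v u hu).trans (hind u (t • v) hu')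
  have e2 := hf (t • v)
  simp only [map_smul, LinearMap.smul_apply] at e2
  rw [← hf v, ← e1, ← sub_eq_zero] at e2
  have e3 : ((t * (1 - t)) * f v) • v = 0 := by rw [← e2]; module
  have e4 := (smul_eq_zero.1 e3).resolve_right hv
  have e5 := (mul_eq_zero.1 e4).resolve_left (mul_ne_zero ht0 (sub_ne_zero.2 ht1.symm))
  rw [← hf v, e5, zero_smul]

/-- In characteristic 2, an alternating algebra with `[u, v] ∈ Fu + Fv` for all `u, v` is some
`𝔪_{θ,θ}`. -/
theorem exists_eq_algM_of_mul_mem_span [CharP F 2] (b : Module.Basis (Fin n) F V)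
    {𝔤 : Alg F V} (hc : ∀ u v, 𝔤 u v = 𝔤 v u) (hd : ∀ v, 𝔤 v v = 0)
    (h : ∀ u v, 𝔤 u v ∈ Submodule.span F {u, v}) :
    ∃ θ : Module.Dual F V, 𝔤 = algM θ θ := by
  choose x y hxy using fun u v => Submodule.mem_span_pair.1 (h u v)
  have hconst : ∀ i j k, i ≠ j → i ≠ k → y (b i) (b j) = y (b i) (b k) := by
    intro i j k hij hik
    rcases eq_or_ne j k with rfl | hjk
    · rfl
    have e := hxy (b i) (b j + b k)
    rw [map_add, ← hxy (b i) (b j), ← hxy (b i) (b k)] at e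
    have ej := congrArg (fun x => b.repr x j) e
    have ek := congrArg (fun x => b.repr x k) e
    simp [hij, hik, hjk, hjk.symm] at ej ek
    rw [← ej, ← ek]
  have hθ : ∀ i, ∃ t, ∀ j, i ≠ j → y (b i) (b j) = t := fun i => by
    by_cases h : ∃ j, i ≠ j
    · obtain ⟨j, hj⟩ := h
      exact ⟨_, fun k hk => hconst i k j hk hj⟩
    · exact ⟨0, fun j hj => (h ⟨j, hj⟩).elim⟩
  choose θ hθ using hθ
  refine ⟨b.constr F θ, b.ext fun i => b.ext fun j => ?_⟩
  rw [algM_apply, b.constr_basis, b.constr_basis]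
  rcases eq_or_ne i j with rfl | hij
  · rw [hd, ← add_smul, CharTwo.add_self_eq_zero, zero_smul]
  have e : x (b i) (b j) • b i + y (b i) (b j) • b j =
      x (b j) (b i) • b j + y (b j) (b i) • b i := by
    rw [hxy, hxy, hc]
  have ei := congrArg (fun x => b.repr x i) e
  simp [hij] at ei
  rw [← hxy, ei, hθ i j hij, hθ j i hij.symm]

end Invariant

/-! ### Subrepresentations, quotients and irreducibility -/

section Rep

variable {F G W W' : Type*} [Field F] [Group G] [AddCommGroup W] [Module F W]
  [AddCommGroup W'] [Module F W'] {ρ : Representation F G W} {σ : Representation F G W'}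

theorem isIrreducible_iff_forall : σ.IsIrreducible ↔
    (∃ x : W', x ≠ 0) ∧ ∀ τ : Subrepresentation σ, τ.toSubmodule = ⊥ ∨ τ.toSubmodule = ⊤ := by
  constructor
  · intro h
    refine ⟨?_, fun τ => (eq_bot_or_eq_top τ).imp (congrArg Subrepresentation.toSubmodule)
      (congrArg Subrepresentation.toSubmodule)⟩
    by_contra hx
    push Not at hx
    refine bot_ne_top (α := Subrepresentation σ) (SetLike.ext fun x => ?_)
    rw [hx x]
    exact ⟨fun _ => trivial, fun _ => rfl⟩
  · rintro ⟨⟨x, hx⟩, h⟩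
    have hne : (⊥ : Subrepresentation σ) ≠ ⊤ := fun e => hx <| by
      have : x ∈ (⊤ : Subrepresentation σ) := trivial
      rw [← e] at this
      exact this
    exact { exists_pair_ne := ⟨⊥, ⊤, hne⟩
            eq_bot_or_eq_top := fun τ =>
              (h τ).imp (fun e => Subrepresentation.toSubmodule_injective e)
                fun e => Subrepresentation.toSubmodule_injective e }

theorem IsIrreducible.of_equiv (e : ρ.Equiv σ) (h : ρ.IsIrreducible) : σ.IsIrreducible := by
  rw [isIrreducible_iff_forall] at h ⊢
  obtain ⟨⟨x, hx⟩, h⟩ := h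
  refine ⟨⟨e.toLinearEquiv x, by simpa using hx⟩, fun τ => ?_⟩
  have hs : τ.toSubmodule.comap e.toLinearEquiv.toLinearMap = ⊥ ∨
      τ.toSubmodule.comap e.toLinearEquiv.toLinearMap = ⊤ :=
    h ⟨τ.toSubmodule.comap e.toLinearEquiv.toLinearMap, fun g v hv => by
      have := τ.apply_mem_toSubmodule g hv
      rwa [← LinearMap.comp_apply, ← e.isIntertwining' g] at this⟩
  rw [← Submodule.map_comap_eq_of_surjective e.toLinearEquiv.surjective τ.toSubmodule]
  exact hs.imp (fun h => by rw [h, Submodule.map_bot])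
    fun h => by rw [h, Submodule.map_top, LinearMap.range_eq_top.2 e.toLinearEquiv.surjective]

/-- The quotient by a maximal submodule is irreducible. -/
theorem isIrreducible_quotientRep_of_covBy {X Y : Subrepresentation ρ} (h : Y ⋖ X) :
    (quotientRep X Y).IsIrreducible := by
  rw [isIrreducible_iff_forall]
  constructor
  · obtain ⟨x, hx, hxY⟩ := SetLike.exists_of_lt h.lt
    exact ⟨Submodule.Quotient.mk (⟨x, hx⟩ : X.toSubmodule),
      fun e => hxY ((Submodule.Quotient.mk_eq_zero
        (Y.toSubmodule.submoduleOf X.toSubmodule)).1 e)⟩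
  · intro τ
    let S : Subrepresentation ρ :=
      ⟨(τ.toSubmodule.comap (Submodule.mkQ _)).map X.toSubmodule.subtype, by
        rintro g _ ⟨x, hx, rfl⟩
        exact ⟨X.toRepresentation g x, τ.apply_mem_toSubmodule g hx, rfl⟩⟩
    have hmem : ∀ x : X.toSubmodule, (x : W) ∈ S.toSubmodule ↔
        Submodule.Quotient.mk x ∈ τ.toSubmodule := fun x =>
      ⟨fun ⟨_, hy, hyx⟩ => Subtype.ext hyx ▸ hy, fun hx => ⟨x, hx, rfl⟩⟩
    have hSX : S ≤ X := by
      rintro _ ⟨x, hx, rfl⟩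
      exact x.2
    have hYS : Y ≤ S := fun x hx => (hmem ⟨x, h.le hx⟩).2 (by
      rw [(Submodule.Quotient.mk_eq_zero _).2 (show (⟨x, h.le hx⟩ : X.toSubmodule) ∈ _ from hx)]
      exact zero_mem _)
    rcases h.eq_or_eq hYS hSX with e | e
    · left
      rw [eq_bot_iff]
      intro y hy
      obtain ⟨x, rfl⟩ := Submodule.Quotient.mk_surjective _ y
      have := (hmem x).2 hy
      rw [e] at this
      exact (Submodule.Quotient.mk_eq_zero _).2 this
    · right
      rw [eq_top_iff]
      intro y _
      obtain ⟨x, rfl⟩ := Submodule.Quotient.mk_surjective _ y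
      exact (hmem x).1 (by rw [e]; exact x.2)

/-- A minimal submodule is irreducible. -/
theorem isIrreducible_toRepresentation_of_covBy {X : Subrepresentation ρ} (h : ⊥ ⋖ X) :
    X.toRepresentation.IsIrreducible := by
  rw [isIrreducible_iff_forall]
  constructor
  · obtain ⟨x, hx, hx0⟩ := SetLike.exists_of_lt h.lt
    exact ⟨⟨x, hx⟩, fun e => hx0 (congrArg Subtype.val e)⟩
  · intro τ
    let S : Subrepresentation ρ :=
      ⟨τ.toSubmodule.map X.toSubmodule.subtype, by
        rintro g _ ⟨x, hx, rfl⟩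
        exact ⟨X.toRepresentation g x, τ.apply_mem_toSubmodule g hx, rfl⟩⟩
    have hmem : ∀ x : X.toSubmodule, (x : W) ∈ S.toSubmodule ↔ x ∈ τ.toSubmodule := fun x =>
      ⟨fun ⟨_, hy, hyx⟩ => Subtype.ext hyx ▸ hy, fun hx => ⟨x, hx, rfl⟩⟩
    have hSX : S ≤ X := by
      rintro _ ⟨x, hx, rfl⟩
      exact x.2
    rcases h.eq_or_eq bot_le hSX with e | e
    · left
      rw [eq_bot_iff]
      intro y hy
      have := (hmem y).2 hy
      rw [e] at this
      exact Subtype.ext this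
    · right
      rw [eq_top_iff]
      intro y _
      exact (hmem y).1 (by rw [e]; exact y.2)

/-- The first isomorphism theorem for `quotientRep`. -/
theorem nonempty_quotientRep_equiv {X Y : Subrepresentation ρ} (f : X.toSubmodule →ₗ[F] W')
    (hf : ∀ g x, f (X.toRepresentation g x) = σ g (f x))
    (hker : ∀ x : X.toSubmodule, f x = 0 ↔ (x : W) ∈ Y.toSubmodule)
    (hsurj : Function.Surjective f) : Nonempty ((quotientRep X Y).Equiv σ) := by
  have hk : Y.toSubmodule.submoduleOf X.toSubmodule = LinearMap.ker f := by
    ext x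
    exact (hker x).symm
  refine ⟨Representation.Equiv.mk
    ((Submodule.quotEquivOfEq _ _ hk).trans (f.quotKerEquivOfSurjective hsurj)) fun g => ?_⟩
  refine LinearMap.ext fun y => ?_
  obtain ⟨x, rfl⟩ := Submodule.Quotient.mk_surjective _ y
  exact hf g x

end Rep

/-! ### Composition series as lists -/

section Series

variable {A G W : Type*} [Ring A] [Monoid G] [AddCommGroup W] [Module A W]
  {ρ : Representation A G W}

/-- The lists `l` for which `a :: l` is a maximal chain from `a` to `X`. -/
def chainsTo {α : Type*} [PartialOrder α] (X a : α) : Set (List α) :=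
  {l | (a :: l).IsChain (· ⋖ ·) ∧ (a :: l).getLast (List.cons_ne_nil a l) = X}

section Chains

variable {α : Type*} [PartialOrder α]

theorem le_of_mem_chainsTo {X a : α} {l : List α} (h : l ∈ chainsTo X a) : a ≤ X := by
  induction l generalizing a with
  | nil => exact h.2.le
  | cons c l ih =>
    obtain ⟨h1, h2⟩ := h
    rw [List.isChain_cons_cons] at h1
    exact h1.1.le.trans (ih ⟨h1.2, by simpa using h2⟩)

theorem chainsTo_self (X : α) : chainsTo X X = {[]} := by
  ext l
  rw [Set.mem_singleton_iff]
  constructor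
  · intro h
    cases l with
    | nil => rfl
    | cons c l =>
      obtain ⟨h1, h2⟩ := h
      rw [List.isChain_cons_cons] at h1
      exact (h1.1.lt.not_ge (le_of_mem_chainsTo (l := l) ⟨h1.2, by simpa using h2⟩)).elim
  · rintro rfl
    exact ⟨by simp, rfl⟩

theorem chainsTo_of_unique_cover {X a c : α} (hc : a < c) (hcX : c ≤ X)
    (h : ∀ d ≤ X, a < d → c ≤ d) : chainsTo X a = List.cons c '' chainsTo X c := by
  ext l
  constructor
  · intro hl
    cases l with
    | nil => exact ((hc.trans_le hcX).ne hl.2).elim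
    | cons d l =>
      obtain ⟨h1, h2⟩ := hl
      rw [List.isChain_cons_cons] at h1
      have hl : l ∈ chainsTo X d := ⟨h1.2, by simpa using h2⟩
      have hcd := h d (le_of_mem_chainsTo hl) h1.1.lt
      obtain rfl : c = d := hcd.eq_of_not_lt fun hlt => h1.1.2 hc hlt
      exact ⟨l, hl, rfl⟩
  · rintro ⟨l, hl, rfl⟩
    refine ⟨List.isChain_cons_cons.2 ⟨⟨hc, fun d h1 h2 => ?_⟩, hl.1⟩, by simpa using hl.2⟩
    exact (h d (h2.le.trans hcX) h1).not_gt h2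

theorem chainsTo_of_two_covers {X a c c' : α} (hc : a < c) (hc' : a < c') (hcX : c ≤ X)
    (hcX' : c' ≤ X) (hn : ¬ c ≤ c') (hn' : ¬ c' ≤ c)
    (h : ∀ d ≤ X, a < d → c ≤ d ∨ c' ≤ d) :
    chainsTo X a = List.cons c '' chainsTo X c ∪ List.cons c' '' chainsTo X c' := by
  ext l
  constructor
  · intro hl
    cases l with
    | nil => exact ((hc.trans_le hcX).ne hl.2).elim
    | cons d l =>
      obtain ⟨h1, h2⟩ := hl
      rw [List.isChain_cons_cons] at h1
      have hl : l ∈ chainsTo X d := ⟨h1.2, by simpa using h2⟩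
      rcases h d (le_of_mem_chainsTo hl) h1.1.lt with hcd | hcd
      · obtain rfl : c = d := hcd.eq_of_not_lt fun hlt => h1.1.2 hc hlt
        exact Or.inl ⟨l, hl, rfl⟩
      · obtain rfl : c' = d := hcd.eq_of_not_lt fun hlt => h1.1.2 hc' hlt
        exact Or.inr ⟨l, hl, rfl⟩
  · rintro (⟨l, hl, rfl⟩ | ⟨l, hl, rfl⟩)
    · refine ⟨List.isChain_cons_cons.2 ⟨⟨hc, fun d h1 h2 => ?_⟩, hl.1⟩, by simpa using hl.2⟩
      rcases h d (h2.le.trans hcX) h1 with h3 | h3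
      · exact h3.not_gt h2
      · exact hn' (h3.trans h2.le)
    · refine ⟨List.isChain_cons_cons.2 ⟨⟨hc', fun d h1 h2 => ?_⟩, hl.1⟩, by simpa using hl.2⟩
      rcases h d (h2.le.trans hcX') h1 with h3 | h3
      · exact hn (h3.trans h2.le)
      · exact h3.not_gt h2

end Chains

theorem toList_image_compositionSeriesOf (X : Subrepresentation ρ) :
    RelSeries.toList '' compositionSeriesOf X = List.cons ⊥ '' chainsTo X ⊥ := by
  ext l
  constructor
  · rintro ⟨s, ⟨h1, h2⟩, rfl⟩
    have hc := s.isChain_toList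
    have h1' := s.head_toList.trans h1
    have h2' := s.getLast_toList.trans h2
    obtain ⟨a, l, hl⟩ := List.exists_cons_of_ne_nil s.toList_ne_nil
    simp only [hl, List.head_cons] at hc h1' h2' ⊢
    subst h1'
    exact ⟨l, ⟨hc, h2'⟩, rfl⟩
  · rintro ⟨l, ⟨h1, h2⟩, rfl⟩
    refine ⟨RelSeries.fromListIsChain (⊥ :: l) (List.cons_ne_nil _ _) h1, ⟨?_, ?_⟩,
      RelSeries.toList_fromListIsChain _ _ h1⟩
    · rw [← RelSeries.head_toList]
      simp [RelSeries.toList_fromListIsChain]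
    · rw [← RelSeries.getLast_toList]
      simp only [RelSeries.toList_fromListIsChain]
      exact h2

theorem encard_compositionSeriesOf (X : Subrepresentation ρ) :
    (compositionSeriesOf X).encard = (RelSeries.toList '' compositionSeriesOf X).encard :=
  (RelSeries.toList_injective.injOn.encard_image).symm

/-! ### Maximal chains in small lattices -/

section Small

variable {α : Type*} [PartialOrder α] [OrderBot α] {M N U K C : α}

theorem chainsTo_bot_of_two_atoms (h : ∀ S ≤ C, S = ⊥ ∨ S = M ∨ S = N ∨ S = C)
    (hM : ⊥ < M) (hN : ⊥ < N) (hMC : M < C) (hNC : N < C) (hMN : ¬ M ≤ N) (hNM : ¬ N ≤ M) :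
    chainsTo C (⊥ : α) = {[N, C], [M, C]} := by
  rw [chainsTo_of_two_covers hN hM hNC.le hMC.le hNM hMN (by grind),
    chainsTo_of_unique_cover hNC le_rfl (by grind),
    chainsTo_of_unique_cover hMC le_rfl (by grind), chainsTo_self]
  ext l
  simp
  tauto

theorem chainsTo_bot_of_chain (h : ∀ S ≤ C, S = ⊥ ∨ S = M ∨ S = N ∨ S = C)
    (hM : ⊥ < M) (hMN : M < N) (hNC : N < C) : chainsTo C (⊥ : α) = {[M, N, C]} := by
  rw [chainsTo_of_unique_cover hM (hMN.trans hNC).le (by grind),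
    chainsTo_of_unique_cover hMN hNC.le (by grind),
    chainsTo_of_unique_cover hNC le_rfl (by grind), chainsTo_self]
  simp

theorem chainsTo_bot_of_chain_of_diamond
    (h : ∀ S ≤ C, S = ⊥ ∨ S = M ∨ S = U ∨ S = K ∨ S = N ∨ S = C) (hM : ⊥ < M) (hMU : M < U)
    (hUK : U < K) (hUN : U < N) (hKC : K < C) (hNC : N < C) (hKN : ¬ K ≤ N) (hNK : ¬ N ≤ K) :
    chainsTo C (⊥ : α) = {[M, U, K, C], [M, U, N, C]} := by
  rw [chainsTo_of_unique_cover hM ((hMU.trans hUK).trans hKC).le (by grind),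
    chainsTo_of_unique_cover hMU (hUK.trans hKC).le (by grind),
    chainsTo_of_two_covers hUK hUN hKC.le hNC.le hKN hNK (by grind),
    chainsTo_of_unique_cover hKC le_rfl (by grind),
    chainsTo_of_unique_cover hNC le_rfl (by grind), chainsTo_self]
  ext l
  simp
  tauto

theorem chainsTo_bot_of_atom_of_diamond
    (h : ∀ S ≤ C, S = ⊥ ∨ S = M ∨ S = U ∨ S = K ∨ S = N ∨ S = C) (hM : ⊥ < M) (hU : ⊥ < U)
    (hMK : M < K) (hMN : ¬ M ≤ N) (hUM : ¬ U ≤ M)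
    (hUK : U < K) (hUN : U < N) (hKC : K < C) (hNC : N < C) (hKN : ¬ K ≤ N) (hNK : ¬ N ≤ K) :
    chainsTo C (⊥ : α) = {[U, K, C], [M, K, C], [U, N, C]} := by
  rw [chainsTo_of_two_covers hU hM (hUK.trans hKC).le (hMK.trans hKC).le hUM
      (fun h => hMN (h.trans hUN.le)) (by grind),
    chainsTo_of_unique_cover hMK hKC.le (by grind),
    chainsTo_of_two_covers hUK hUN hKC.le hNC.le hKN hNK (by grind),
    chainsTo_of_unique_cover hKC le_rfl (by grind),
    chainsTo_of_unique_cover hNC le_rfl (by grind), chainsTo_self]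
  ext l
  simp
  tauto

end Small

end Series

/-! ### The submodules of `𝒞` -/

section Submodules

variable {F V : Type*} [Field F] [AddCommGroup V] [Module F V] {n : ℕ}
  (b : Module.Basis (Fin n) F V)

/-- The invariant subspace of algebras that corresponds to a submodule of `Λ`. -/
def algebrasOf (S : Subrepresentation (repΛ b)) : Submodule F (Alg F V) :=
  S.toSubmodule.comap (Θ b).toLinearMap

variable {b}

theorem Θ_algAct (g : V ≃ₗ[F] V) (𝔤 : Alg F V) : Θ b (algAct g 𝔤) = repΛ b (op g) (Θ b 𝔤) := by
  simp [repΛ]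

theorem isInvariant_algebrasOf (S : Subrepresentation (repΛ b)) :
    IsInvariant (algebrasOf b S) := fun g 𝔤 h => by
  have : Θ b (algAct g 𝔤) ∈ S.toSubmodule := by
    rw [Θ_algAct]
    exact S.apply_mem_toSubmodule _ h
  exact this

theorem symm_mem_algebrasOf {S : Subrepresentation (repΛ b)} {l : StrVec F n} (h : l ∈ S) :
    (Θ b).symm l ∈ algebrasOf b S := by
  have : Θ b ((Θ b).symm l) ∈ S.toSubmodule := by rwa [LinearEquiv.apply_symm_apply]
  exact this

theorem mem_of_symm_mem_algebrasOf {S : Subrepresentation (repΛ b)} {l : StrVec F n}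
    (h : (Θ b).symm l ∈ algebrasOf b S) : l ∈ S := by
  have : Θ b ((Θ b).symm l) ∈ S.toSubmodule := h
  rwa [LinearEquiv.apply_symm_apply] at this

theorem algebrasOf_mono {S T : Subrepresentation (repΛ b)} (h : S ≤ T) :
    algebrasOf b S ≤ algebrasOf b T := fun _ h𝔤 => h h𝔤

theorem le_of_algebrasOf_le {S T : Subrepresentation (repΛ b)}
    (h : algebrasOf b S ≤ algebrasOf b T) : S ≤ T := fun _ hl =>
  mem_of_symm_mem_algebrasOf (h (symm_mem_algebrasOf hl))

theorem mem_subC_iff {𝔤 : Alg F V} : 𝔤 ∈ algebrasOf b (subC b) ↔ ∀ u v, 𝔤 u v = 𝔤 v u := by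
  change (∀ u v, (Θ b).symm (Θ b 𝔤) u v = (Θ b).symm (Θ b 𝔤) v u) ↔ _
  rw [LinearEquiv.symm_apply_apply]

theorem mem_subK_iff {𝔤 : Alg F V} : 𝔤 ∈ algebrasOf b (subK b) ↔ ∀ v, 𝔤 v v = 0 := by
  change (∀ v, (Θ b).symm (Θ b 𝔤) v v = 0) ↔ _
  rw [LinearEquiv.symm_apply_apply]

theorem mem_subT_iff {𝔤 : Alg F V} : 𝔤 ∈ algebrasOf b (subT b) ↔ trForm F V 𝔤 = 0 := by
  change (∀ u, LinearMap.trace F V ((Θ b).symm (Θ b 𝔤) u) = 0) ↔ _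
  rw [LinearEquiv.symm_apply_apply, LinearMap.ext_iff]
  rfl

theorem mem_subMstarstar_iff {𝔤 : Alg F V} :
    𝔤 ∈ algebrasOf b (subMstarstar b) ↔ ∀ v, 𝔤 v v ∈ Submodule.span F {v} := by
  change (∀ v, (Θ b).symm (Θ b 𝔤) v v ∈ _) ↔ _
  rw [LinearEquiv.symm_apply_apply]

theorem mem_subMstarP_iff {𝔤 : Alg F V} :
    𝔤 ∈ algebrasOf b (subMstarP b 1 1) ↔ ∃ θ : Module.Dual F V, 𝔤 = algM θ θ := by
  change (∃ θ : Module.Dual F V, Θ b 𝔤 = Θ b (algM ((1 : F) • θ) ((1 : F) • θ))) ↔ _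
  simp

theorem mem_subN_iff {𝔤 : Alg F V} :
    𝔤 ∈ algebrasOf b (subN b) ↔ (∀ u v, 𝔤 u v = 𝔤 v u) ∧ trForm F V 𝔤 = 0 :=
  and_congr mem_subC_iff mem_subT_iff

theorem mem_subU_iff {𝔤 : Alg F V} :
    𝔤 ∈ algebrasOf b (subU b) ↔ (∀ v, 𝔤 v v = 0) ∧ trForm F V 𝔤 = 0 :=
  and_congr mem_subK_iff mem_subT_iff

theorem subMstarP_le_subC : subMstarP b 1 1 ≤ subC b := le_of_algebrasOf_le fun 𝔤 h => by
  obtain ⟨θ, rfl⟩ := mem_subMstarP_iff.1 h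
  exact mem_subC_iff.2 fun u v => by simp [add_comm]

theorem subN_le_subC : subN b ≤ subC b := inf_le_left

/-- Since the dual space is irreducible, `𝓜*_{(1,1)}` is a minimal submodule. -/
theorem eq_bot_or_eq_of_le_subMstarP {S : Subrepresentation (repΛ b)} (h : S ≤ subMstarP b 1 1) :
    S = ⊥ ∨ S = subMstarP b 1 1 := by
  have := Module.Finite.of_basis b
  refine (isInvariant_algebrasOf S).algM_notMem_or_mem.imp (fun h0 => ?_) fun h1 => ?_
  · refine eq_bot_iff.2 fun l hl => ?_
    have hl' := symm_mem_algebrasOf hl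
    obtain ⟨θ, hθ⟩ := mem_subMstarP_iff.1 (algebrasOf_mono h hl')
    rw [hθ] at hl'
    have hz : (Θ b).symm l = 0 := by rw [hθ, h0 θ hl']; ext; simp
    exact (Θ b).symm.map_eq_zero_iff.1 hz
  · refine le_antisymm h (le_of_algebrasOf_le fun 𝔤 h𝔤 => ?_)
    obtain ⟨θ, rfl⟩ := mem_subMstarP_iff.1 h𝔤
    exact h1 θ

/-- Since the dual space is irreducible, there is no submodule strictly between `X ∩ 𝒯`
and `X`. -/
theorem eq_or_eq_of_inf_subT_le {S X : Subrepresentation (repΛ b)} (h : X ⊓ subT b ≤ S)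
    (hX : S ≤ X) : S = X ⊓ subT b ∨ S = X := by
  have := Module.Finite.of_basis b
  refine (isInvariant_algebrasOf S).trForm_eq_zero_or_surjective.imp (fun h0 => ?_) fun h1 => ?_
  · exact le_antisymm (le_inf hX (le_of_algebrasOf_le fun 𝔤 h𝔤 => mem_subT_iff.2 (h0 𝔤 h𝔤))) h
  · refine le_antisymm hX (le_of_algebrasOf_le fun 𝔤 h𝔤 => ?_)
    obtain ⟨𝔥, h𝔥, htr⟩ := h1 (trForm F V 𝔤)
    have hsub : 𝔤 - 𝔥 ∈ algebrasOf b (X ⊓ subT b) :=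
      ⟨(algebrasOf b X).sub_mem h𝔤 (algebrasOf_mono hX h𝔥),
        mem_subT_iff.2 (by rw [map_sub, htr, sub_self])⟩
    simpa using (algebrasOf b S).add_mem (algebrasOf_mono h hsub) h𝔥

theorem eq_of_le_subC_of_two_ne_zero (hn : 3 ≤ n) (hF : ∃ t : F, t ≠ 0 ∧ t ≠ 1)
    (h2 : (2 : F) ≠ 0) (S : Subrepresentation (repΛ b)) (hS : S ≤ subC b) :
    S = ⊥ ∨ S = subMstarP b 1 1 ∨ S = subN b ∨ S = subC b := by
  have hC : ∀ 𝔤 ∈ algebrasOf b S, ∀ u v, 𝔤 u v = 𝔤 v u := fun 𝔤 h =>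
    mem_subC_iff.1 (algebrasOf_mono hS h)
  rcases (isInvariant_algebrasOf S).traceless_mem_or_sq_mem_span hn hF b hC with h | h
  · have hN : subC b ⊓ subT b ≤ S := le_of_algebrasOf_le fun 𝔤 h𝔤 =>
      h 𝔤 (mem_subN_iff.1 h𝔤).1 (mem_subN_iff.1 h𝔤).2
    exact Or.inr (Or.inr (eq_or_eq_of_inf_subT_le hN hS))
  · have hM : S ≤ subMstarP b 1 1 := le_of_algebrasOf_le fun 𝔤 h𝔤 =>
      mem_subMstarP_iff.2 (exists_eq_algM_of_sq_mem_span h2 b (hC 𝔤 h𝔤) (h 𝔤 h𝔤))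
    exact (eq_bot_or_eq_of_le_subMstarP hM).imp_right Or.inl

section CharTwo

variable [CharP F 2]

theorem mul_comm_of_sq_eq_zero {𝔤 : Alg F V} (h : ∀ v, 𝔤 v v = 0) (u v : V) :
    𝔤 u v = 𝔤 v u := by
  have e := h (u + v)
  simp only [map_add, LinearMap.add_apply, h, zero_add, add_zero] at e
  have e2 : (2 : F) • 𝔤 v u = 0 := by rw [CharTwo.two_eq_zero, zero_smul]
  linear_combination (norm := module) e - e2

theorem subK_le_subC : subK b ≤ subC b := le_of_algebrasOf_le fun _ h =>
  mem_subC_iff.2 (mul_comm_of_sq_eq_zero (mem_subK_iff.1 h))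

theorem subMstarP_le_subK : subMstarP b 1 1 ≤ subK b := le_of_algebrasOf_le fun 𝔤 h => by
  obtain ⟨θ, rfl⟩ := mem_subMstarP_iff.1 h
  refine mem_subK_iff.2 fun v => ?_
  rw [algM_apply, ← two_smul F, CharTwo.two_eq_zero, zero_smul]

theorem eq_of_le_subC_of_charTwo (hn : 3 ≤ n) (hF : ∃ t : F, t ≠ 0 ∧ t ≠ 1)
    (S : Subrepresentation (repΛ b)) (hS : S ≤ subC b) :
    S = ⊥ ∨ S = subMstarP b 1 1 ∨ S = subU b ∨ S = subK b ∨ S = subN b ∨ S = subC b := by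
  have hC : ∀ 𝔤 ∈ algebrasOf b S, ∀ u v, 𝔤 u v = 𝔤 v u := fun 𝔤 h =>
    mem_subC_iff.1 (algebrasOf_mono hS h)
  rcases (isInvariant_algebrasOf S).traceless_mem_or_sq_mem_span hn hF b hC with h | h
  · have hN : subC b ⊓ subT b ≤ S := le_of_algebrasOf_le fun 𝔤 h𝔤 =>
      h 𝔤 (mem_subN_iff.1 h𝔤).1 (mem_subN_iff.1 h𝔤).2
    exact Or.inr (Or.inr (Or.inr (Or.inr (eq_or_eq_of_inf_subT_le hN hS))))
  have hd : ∀ 𝔤 ∈ algebrasOf b S, ∀ v, 𝔤 v v = 0 := fun 𝔤 h𝔤 =>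
    sq_eq_zero_of_sq_mem_span (by omega) hF b (hC 𝔤 h𝔤) (h 𝔤 h𝔤)
  have hK : S ≤ subK b := le_of_algebrasOf_le fun 𝔤 h𝔤 => mem_subK_iff.2 (hd 𝔤 h𝔤)
  rcases (isInvariant_algebrasOf S).traceless_mem_or_mul_mem_span hF b hC hd with h' | h'
  · have hU : subK b ⊓ subT b ≤ S := le_of_algebrasOf_le fun 𝔤 h𝔤 =>
      h' 𝔤 (mul_comm_of_sq_eq_zero (mem_subU_iff.1 h𝔤).1) (mem_subU_iff.1 h𝔤).1
        (mem_subU_iff.1 h𝔤).2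
    rcases eq_or_eq_of_inf_subT_le hU hK with e | e
    · exact Or.inr (Or.inr (Or.inl e))
    · exact Or.inr (Or.inr (Or.inr (Or.inl e)))
  · have hM : S ≤ subMstarP b 1 1 := le_of_algebrasOf_le fun 𝔤 h𝔤 =>
      mem_subMstarP_iff.2 (exists_eq_algM_of_mul_mem_span b (hC 𝔤 h𝔤) (hd 𝔤 h𝔤) (h' 𝔤 h𝔤))
    exact (eq_bot_or_eq_of_le_subMstarP hM).imp_right Or.inl

end CharTwo

/-! ### Position of the submodules -/

theorem trForm_algM (b : Module.Basis (Fin n) F V) (θ : Module.Dual F V) :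
    trForm F V (algM θ θ) = ((n : F) + 1) • θ := by
  ext u
  rw [trForm_apply, trace_algM b]
  rfl

theorem subMstarP_le_subT (h : (n : F) + 1 = 0) : subMstarP b 1 1 ≤ subT b :=
  le_of_algebrasOf_le fun 𝔤 h𝔤 => by
    obtain ⟨θ, rfl⟩ := mem_subMstarP_iff.1 h𝔤
    exact mem_subT_iff.2 (by rw [trForm_algM b, h, zero_smul])

theorem rankOne_mem_subN {i j : Fin n} (h : i ≠ j) :
    rankOne (b.coord i) (b.coord i) (b j) ∈ algebrasOf b (subN b) := by
  refine mem_subN_iff.2 ⟨fun u v => by simp [smul_smul, mul_comm], ?_⟩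
  ext u
  rw [trForm_apply, trace_rankOne b]
  simp [h.symm]

/-- The square `eᵢ² ⊗ bᵢ` is commutative with adjoint trace form `eᵢ`. -/
theorem exists_mem_subC_trForm_ne_zero (hn : 0 < n) :
    ∃ 𝔤 ∈ algebrasOf b (subC b), trForm F V 𝔤 ≠ 0 := by
  let i : Fin n := ⟨0, hn⟩
  refine ⟨rankOne (b.coord i) (b.coord i) (b i),
    mem_subC_iff.2 fun u v => by simp [smul_smul, mul_comm], fun h => ?_⟩
  have := LinearMap.congr_fun h (b i)
  rw [trForm_apply, trace_rankOne b] at this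
  simp at this

theorem bot_lt_subMstarP (hn : 3 ≤ n) : ⊥ < subMstarP b 1 1 := by
  refine bot_lt_iff_ne_bot.2 fun h => ?_
  have hm : algM (b.coord ⟨0, by omega⟩) (b.coord ⟨0, by omega⟩) ∈
    algebrasOf b (subMstarP b 1 1) := mem_subMstarP_iff.2 ⟨_, rfl⟩
  rw [h] at hm
  have h0 := (Θ b).map_eq_zero_iff.1 hm
  have := LinearMap.congr_fun (LinearMap.congr_fun h0 (b ⟨0, by omega⟩)) (b ⟨1, by omega⟩)
  simp [b.ne_zero] at this

theorem not_subN_le_subMstarP (hn : 3 ≤ n) : ¬ subN b ≤ subMstarP b 1 1 := fun h => by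
  have hm := algebrasOf_mono h (rankOne_mem_subN (b := b) (i := ⟨0, by omega⟩)
    (j := ⟨1, by omega⟩) (by simp))
  obtain ⟨θ, hθ⟩ := mem_subMstarP_iff.1 hm
  have := congrArg (fun x => b.repr x ⟨1, by omega⟩)
    (LinearMap.congr_fun (LinearMap.congr_fun hθ (b ⟨0, by omega⟩)) (b ⟨0, by omega⟩))
  simp at this

theorem not_subN_le_subK (hn : 3 ≤ n) : ¬ subN b ≤ subK b := fun h => by
  have hm := mem_subK_iff.1 (algebrasOf_mono h (rankOne_mem_subN (b := b) (i := ⟨0, by omega⟩)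
    (j := ⟨1, by omega⟩) (by simp))) (b ⟨0, by omega⟩)
  simp [b.ne_zero] at hm

theorem subN_lt_subC (hn : 3 ≤ n) : subN b < subC b := by
  refine lt_of_le_of_ne subN_le_subC fun h => ?_
  obtain ⟨𝔤, h𝔤, htr⟩ := exists_mem_subC_trForm_ne_zero (b := b) (by omega)
  rw [← h] at h𝔤
  exact htr (mem_subN_iff.1 h𝔤).2

theorem not_subMstarP_le_subT (hn : 3 ≤ n) (h : (n : F) + 1 ≠ 0) :
    ¬ subMstarP b 1 1 ≤ subT b := fun hle => by
  have hm := mem_subT_iff.1 (algebrasOf_mono hle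
    (mem_subMstarP_iff.2 ⟨b.coord ⟨0, by omega⟩, rfl⟩))
  rw [trForm_algM b] at hm
  exact coord_ne_zero b _ ((smul_eq_zero.1 hm).resolve_left h)

theorem subMstarP_lt_subC (hn : 3 ≤ n) : subMstarP b 1 1 < subC b :=
  lt_of_le_of_ne subMstarP_le_subC fun h =>
    not_subN_le_subMstarP (b := b) hn (h ▸ subN_le_subC)

section CharTwo

variable [CharP F 2]

theorem symOne_mem_subK (φ ψ : Module.Dual F V) (w : V) :
    symOne φ ψ w ∈ algebrasOf b (subK b) := by
  refine mem_subK_iff.2 fun v => ?_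
  have h : (2 : F) • φ v • ψ v • w = 0 := by rw [CharTwo.two_eq_zero, zero_smul]
  rw [symOne_apply, ← h]
  module

/-- In characteristic 2 the product `eᵢ eⱼ ⊗ bⱼ` is alternating with adjoint trace form `eᵢ`. -/
theorem exists_mem_subK_trForm_ne_zero (hn : 3 ≤ n) :
    ∃ 𝔤 ∈ algebrasOf b (subK b), trForm F V 𝔤 ≠ 0 := by
  refine ⟨_, symOne_mem_subK (b.coord ⟨0, by omega⟩) (b.coord ⟨1, by omega⟩) (b ⟨1, by omega⟩),
    fun h => ?_⟩
  have := LinearMap.congr_fun h (b ⟨0, by omega⟩)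
  rw [trForm_apply, trace_symOne b] at this
  simp at this

theorem not_subU_le_subMstarP (hn : 3 ≤ n) : ¬ subU b ≤ subMstarP b 1 1 := fun h => by
  have hm : symOne (b.coord ⟨0, by omega⟩) (b.coord ⟨1, by omega⟩) (b ⟨2, by omega⟩) ∈
      algebrasOf b (subU b) := by
    refine mem_subU_iff.2 ⟨mem_subK_iff.1 (symOne_mem_subK (b := b) _ _ _), ?_⟩
    ext u
    rw [trForm_apply, trace_symOne b]
    simp
  obtain ⟨θ, hθ⟩ := mem_subMstarP_iff.1 (algebrasOf_mono h hm)
  have := congrArg (fun x => b.repr x ⟨2, by omega⟩)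
    (LinearMap.congr_fun (LinearMap.congr_fun hθ (b ⟨0, by omega⟩)) (b ⟨1, by omega⟩))
  simp at this

theorem not_subK_le_subN (hn : 3 ≤ n) : ¬ subK b ≤ subN b := fun h => by
  obtain ⟨𝔤, h𝔤, htr⟩ := exists_mem_subK_trForm_ne_zero (b := b) hn
  exact htr (mem_subN_iff.1 (algebrasOf_mono h h𝔤)).2

theorem subU_eq_inf : subN b ⊓ subK b = subU b := by
  refine le_antisymm (le_inf inf_le_right (inf_le_left.trans inf_le_right))
    (le_inf (le_inf (inf_le_left.trans subK_le_subC) inf_le_right) inf_le_left)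

theorem subU_lt_subN (hn : 3 ≤ n) : subU b < subN b := by
  rw [← subU_eq_inf]
  exact inf_lt_left.2 (not_subN_le_subK hn)

theorem subU_lt_subK (hn : 3 ≤ n) : subU b < subK b := by
  rw [← subU_eq_inf]
  exact inf_lt_right.2 (not_subK_le_subN hn)

theorem subK_lt_subC (hn : 3 ≤ n) : subK b < subC b :=
  lt_of_le_of_ne subK_le_subC fun h => not_subN_le_subK (b := b) hn (h ▸ subN_le_subC)

end CharTwo

/-! ### Factors -/

/-- If the adjoint trace form does not vanish on `X`, it identifies `X / (X ∩ 𝒯)` with the dual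
space. -/
theorem nonempty_quotientRep_equiv_repDual {X Y : Subrepresentation (repΛ b)}
    (hY : X ⊓ subT b = Y) (h : ∃ 𝔤 ∈ algebrasOf b X, trForm F V 𝔤 ≠ 0) :
    Nonempty ((quotientRep X Y).Equiv (repDual F V)) := by
  have := Module.Finite.of_basis b
  subst hY
  refine nonempty_quotientRep_equiv
    (trForm F V ∘ₗ (Θ b).symm.toLinearMap ∘ₗ X.toSubmodule.subtype) (fun g x => ?_)
    (fun x => ?_) fun θ => ?_
  · have : (Θ b).symm (repΛ b g x) = algAct (unop g) ((Θ b).symm x) := by simp [repΛ]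
    change trForm F V ((Θ b).symm (repΛ b g x)) = _
    rw [this, trForm_algAct]
    rfl
  · change trForm F V ((Θ b).symm x) = 0 ↔ _
    rw [LinearMap.ext_iff]
    exact ⟨fun h => ⟨x.2, h⟩, fun h => h.2⟩
  · rcases (isInvariant_algebrasOf X).trForm_eq_zero_or_surjective with h0 | h1
    · obtain ⟨𝔤, h𝔤, hne⟩ := h
      exact (hne (h0 𝔤 h𝔤)).elim
    · obtain ⟨𝔤, h𝔤, rfl⟩ := h1 θ
      exact ⟨⟨Θ b 𝔤, h𝔤⟩, by simp⟩

/-- In characteristic 2, the squaring map of a commutative algebra, as a linear function of the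
structure vector. -/
def squaring (b : Module.Basis (Fin n) F V) [CharP F 2] :
    (subC b).toSubmodule →ₗ[F] (V →ₛₗ[frobenius F 2] V) where
  toFun l :=
    { toFun := fun v => (Θ b).symm l v v
      map_add' := fun u v => by
        have h : (2 : F) • (Θ b).symm (l : StrVec F n) u v = 0 := by
          rw [CharTwo.two_eq_zero, zero_smul]
        have hc := l.2 v u
        rw [map_add, map_add, LinearMap.add_apply, LinearMap.add_apply, hc]
        linear_combination (norm := module) h
      map_smul' := fun c v => by simp [frobenius_def, sq, smul_smul] }
  map_add' _ _ := by ext; simp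
  map_smul' _ _ := by ext; simp

@[simp]
theorem squaring_apply [CharP F 2] (l : (subC b).toSubmodule) (v : V) :
    squaring b l v = (Θ b).symm (l : StrVec F n) v v := rfl

theorem squaring_surjective [CharP F 2] : Function.Surjective (squaring b) := fun φ => by
  set 𝔤 : Alg F V := ∑ i, rankOne (b.coord i) (b.coord i) (φ (b i)) with h𝔤
  have hmem : 𝔤 ∈ algebrasOf b (subC b) := mem_subC_iff.2 fun u v => by
    simp [h𝔤, LinearMap.sum_apply, smul_smul, mul_comm]
  have key : ∀ v, 𝔤 v v = φ v := fun v => by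
    conv_rhs => rw [← b.sum_repr v, map_sum]
    simp [h𝔤, LinearMap.sum_apply, frobenius_def, sq, smul_smul]
  refine ⟨⟨Θ b 𝔤, hmem⟩, LinearMap.ext fun v => ?_⟩
  rw [squaring_apply, LinearEquiv.symm_apply_apply, key]

theorem nonempty_quotientRep_equiv_repΓ [CharP F 2] :
    Nonempty ((quotientRep (subC b) (subK b)).Equiv (repΓ F V)) := by
  refine nonempty_quotientRep_equiv (squaring b) (fun g x => ?_) (fun x => ?_)
    squaring_surjective
  · ext v
    exact Θ_symm_repΛ b g x v v
  · exact ⟨fun h v => LinearMap.congr_fun h v, fun h => LinearMap.ext h⟩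

end Submodules

theorem exists_ne_zero_ne_one {F : Type*} [Field F] (hF : 2 < ENat.card F) :
    ∃ t : F, t ≠ 0 ∧ t ≠ 1 := by
  by_contra! h
  have hsub : (Set.univ : Set F) ⊆ {0, 1} := fun t _ => by
    rcases eq_or_ne t 0 with h0 | h0
    · exact Or.inl h0
    · exact Or.inr (h t h0)
  have := (Set.encard_le_encard hsub).trans (Set.encard_pair (zero_ne_one' F)).le
  rw [Set.encard_univ] at this
  exact this.not_gt hF

/-! ### The two cases of the theorem -/

section Cases

variable {F V : Type*} [Field F] [AddCommGroup V] [Module F V] {n : ℕ}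
  {b : Module.Basis (Fin n) F V}

theorem properSubmodules_eq_of_two_ne_zero (hn : 3 ≤ n) (hF : ∃ t : F, t ≠ 0 ∧ t ≠ 1)
    (h2 : (2 : F) ≠ 0) : properSubmodules (subC b) = {subN b, subMstarP b 1 1} := by
  have hcl := eq_of_le_subC_of_two_ne_zero (b := b) hn hF h2
  have hM := bot_lt_subMstarP (b := b) hn
  have hMC := subMstarP_lt_subC (b := b) hn
  have hNC := subN_lt_subC (b := b) hn
  have hN : subN b ≠ ⊥ := fun h => not_subN_le_subMstarP (b := b) hn (h ▸ bot_le)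
  ext S
  constructor
  · rintro ⟨h0, h1⟩
    rcases hcl S h1.le with rfl | rfl | rfl | rfl
    · exact (h0 rfl).elim
    · exact Or.inr rfl
    · exact Or.inl rfl
    · exact (lt_irrefl _ h1).elim
  · rintro (rfl | rfl)
    · exact ⟨hN, hNC⟩
    · exact ⟨hM.ne', hMC⟩

theorem subN_inf_subMstarstar (h2 : (2 : F) ≠ 0) (hc : (n : F) + 1 ≠ 0) :
    subN b ⊓ subMstarstar b = ⊥ := by
  refine eq_bot_iff.2 fun l hl => ?_
  have hN := mem_subN_iff.1 (symm_mem_algebrasOf hl.1)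
  obtain ⟨θ, hθ⟩ := exists_eq_algM_of_sq_mem_span h2 b hN.1
    (mem_subMstarstar_iff.1 (symm_mem_algebrasOf hl.2))
  have ht := hN.2
  rw [hθ, trForm_algM b] at ht
  have hz : (Θ b).symm l = 0 := by
    rw [hθ, (smul_eq_zero.1 ht).resolve_left hc]; ext; simp
  exact (Θ b).symm.map_eq_zero_iff.1 hz

section CharTwo

variable [CharP F 2]

theorem properSubmodules_eq_of_charTwo (hn : 3 ≤ n) (hF : ∃ t : F, t ≠ 0 ∧ t ≠ 1) :
    properSubmodules (subC b) = {subN b, subMstarP b 1 1, subU b, subK b} := by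
  have hcl := eq_of_le_subC_of_charTwo (b := b) hn hF
  have hM := bot_lt_subMstarP (b := b) hn
  have hMC := subMstarP_lt_subC (b := b) hn
  have hNC := subN_lt_subC (b := b) hn
  have hKC := subK_lt_subC (b := b) hn
  have hUN := subU_lt_subN (b := b) hn
  have hU : subU b ≠ ⊥ := fun h => not_subU_le_subMstarP (b := b) hn (h ▸ bot_le)
  ext S
  simp only [Set.mem_insert_iff, Set.mem_singleton_iff]
  constructor
  · rintro ⟨h0, h1⟩
    rcases hcl S h1.le with e | e | e | e | e | e
    · exact (h0 e).elim
    · exact Or.inr (Or.inl e)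
    · exact Or.inr (Or.inr (Or.inl e))
    · exact Or.inr (Or.inr (Or.inr e))
    · exact Or.inl e
    · exact (h1.ne e).elim
  · rintro (rfl | rfl | rfl | rfl)
    · exact ⟨(bot_le.trans_lt hUN).ne', hNC⟩
    · exact ⟨hM.ne', hMC⟩
    · exact ⟨hU, hUN.trans hNC⟩
    · exact ⟨(bot_le.trans_lt (subU_lt_subK (b := b) hn)).ne', hKC⟩

theorem encard_properSubmodules_of_charTwo (hn : 3 ≤ n) (hF : ∃ t : F, t ≠ 0 ∧ t ≠ 1) :
    (properSubmodules (subC b)).encard = 4 := by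
  have hUN := subU_lt_subN (b := b) hn
  have hUK := subU_lt_subK (b := b) hn
  have hUM := not_subU_le_subMstarP (b := b) hn
  have hNK := not_subN_le_subK (b := b) hn
  rw [properSubmodules_eq_of_charTwo hn hF, Set.encard_insert_of_notMem,
    Set.encard_eq_three.2 ⟨_, _, _, ?_, ?_, ?_, rfl⟩]
  · norm_num
  · exact fun h => hUM h.ge
  · exact fun h => hUM (hUK.le.trans h.ge)
  · exact hUK.ne
  · rintro (h | h | h)
    · exact hUM (hUN.le.trans h.le)
    · exact hUN.ne' h
    · exact hNK (le_of_eq h)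

theorem covBy_subC_iff_of_charTwo (hn : 3 ≤ n) (hF : ∃ t : F, t ≠ 0 ∧ t ≠ 1)
    (S : Subrepresentation (repΛ b)) : S ⋖ subC b ↔ S = subN b ∨ S = subK b := by
  have hcl := eq_of_le_subC_of_charTwo (b := b) hn hF
  have hM := bot_lt_subMstarP (b := b) hn
  have hMC := subMstarP_lt_subC (b := b) hn
  have hMK := subMstarP_le_subK (b := b)
  have hNC := subN_lt_subC (b := b) hn
  have hKC := subK_lt_subC (b := b) hn
  have hUN := subU_lt_subN (b := b) hn
  have hUK := subU_lt_subK (b := b) hn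
  have hUM := not_subU_le_subMstarP (b := b) hn
  have hNK := not_subN_le_subK (b := b) hn
  have hKN := not_subK_le_subN (b := b) hn
  have hMK' : subMstarP b 1 1 < subK b := hMK.lt_of_ne fun h => hUM (hUK.le.trans h.ge)
  constructor
  · intro h
    rcases hcl S h.le with rfl | rfl | rfl | rfl | rfl | rfl
    · exact (h.2 hM hMC).elim
    · exact (h.2 hMK' hKC).elim
    · exact (h.2 hUN hNC).elim
    · exact Or.inr rfl
    · exact Or.inl rfl
    · exact (lt_irrefl _ h.lt).elim
  · rintro (rfl | rfl)
    · refine ⟨hNC, fun T h1 h2 => ?_⟩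
      rcases hcl T h2.le with rfl | rfl | rfl | rfl | rfl | rfl
      · exact h1.not_ge bot_le
      · exact hNK (h1.le.trans hMK)
      · exact h1.not_gt hUN
      · exact hNK h1.le
      · exact lt_irrefl _ h1
      · exact lt_irrefl _ h2
    · refine ⟨hKC, fun T h1 h2 => ?_⟩
      rcases hcl T h2.le with rfl | rfl | rfl | rfl | rfl | rfl
      · exact h1.not_ge bot_le
      · exact h1.not_gt hMK'
      · exact h1.not_gt hUK
      · exact lt_irrefl _ h1
      · exact hKN h1.le
      · exact lt_irrefl _ h2

theorem subU_covBy_subN (hn : 3 ≤ n) (hF : ∃ t : F, t ≠ 0 ∧ t ≠ 1) : subU b ⋖ subN b := by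
  have hcl := eq_of_le_subC_of_charTwo (b := b) hn hF
  refine ⟨subU_lt_subN hn, fun T h1 h2 => ?_⟩
  rcases hcl T (h2.le.trans subN_le_subC) with rfl | rfl | rfl | rfl | rfl | rfl
  · exact h1.not_ge bot_le
  · exact not_subU_le_subMstarP hn h1.le
  · exact lt_irrefl _ h1
  · exact not_subK_le_subN hn h2.le
  · exact lt_irrefl _ h2
  · exact h2.not_ge subN_le_subC

theorem subN_sup_subK (hn : 3 ≤ n) (hF : ∃ t : F, t ≠ 0 ∧ t ≠ 1) :
    subN b ⊔ subK b = subC b := by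
  refine ((covBy_subC_iff_of_charTwo hn hF _).2 (Or.inl rfl)).eq_or_eq le_sup_left
    (sup_le subN_le_subC subK_le_subC) |>.resolve_left fun h => ?_
  exact not_subK_le_subN hn (sup_eq_left.1 h)

end CharTwo

end Cases

end AlgStr

end

theorem mainTheorem2 {F V : Type*} [Field F] [AddCommGroup V] [Module F V] {n : ℕ} (hn : 3 ≤ n)
    (hF : 2 < ENat.card F) (b : Module.Basis (Fin n) F V) :
    -- characteristic different from 2
    (¬ CharP F 2 →
      AlgStr.properSubmodules (AlgStr.subC b) = {AlgStr.subN b, AlgStr.subMstarP b 1 1} ∧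
      (¬ ringChar F ∣ n + 1 →
        AlgStr.subN b ⊓ AlgStr.subMstarstar b = ⊥ ∧
        AlgStr.IsDirectSum (AlgStr.subC b) (AlgStr.subN b) (AlgStr.subMstarP b 1 1) ∧
        (AlgStr.subN b).toRepresentation.IsIrreducible ∧
        (AlgStr.subMstarP b 1 1).toRepresentation.IsIrreducible ∧
        (AlgStr.compositionSeriesOf (AlgStr.subC b)).encard = 2 ∧
        RelSeries.toList '' AlgStr.compositionSeriesOf (AlgStr.subC b) =
          {[⊥, AlgStr.subN b, AlgStr.subC b], [⊥, AlgStr.subMstarP b 1 1, AlgStr.subC b]}) ∧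
      (ringChar F ∣ n + 1 →
        (AlgStr.compositionSeriesOf (AlgStr.subC b)).encard = 1 ∧
        RelSeries.toList '' AlgStr.compositionSeriesOf (AlgStr.subC b) =
          {[⊥, AlgStr.subMstarP b 1 1, AlgStr.subN b, AlgStr.subC b]})) ∧
    -- characteristic 2
    (∀ _ : CharP F 2,
      AlgStr.properSubmodules (AlgStr.subC b) =
        {AlgStr.subN b, AlgStr.subMstarP b 1 1, AlgStr.subU b, AlgStr.subK b} ∧
      (AlgStr.properSubmodules (AlgStr.subC b)).encard = 4 ∧
      AlgStr.subMstarP b 1 1 = AlgStr.subMstarP b 1 (-1) ∧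
      -- the diamond, with its factors
      AlgStr.subN b ⊓ AlgStr.subK b = AlgStr.subU b ∧
      AlgStr.subN b ⊔ AlgStr.subK b = AlgStr.subC b ∧
      AlgStr.subU b < AlgStr.subN b ∧ AlgStr.subU b < AlgStr.subK b ∧
      Nonempty ((AlgStr.quotientRep (AlgStr.subC b) (AlgStr.subN b)).Equiv
        (AlgStr.repDual F V)) ∧
      Nonempty ((AlgStr.quotientRep (AlgStr.subK b) (AlgStr.subU b)).Equiv
        (AlgStr.repDual F V)) ∧
      Nonempty ((AlgStr.quotientRep (AlgStr.subC b) (AlgStr.subK b)).Equiv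
        (AlgStr.repΓ F V)) ∧
      (AlgStr.repΓ F V).IsIrreducible ∧
      (AlgStr.quotientRep (AlgStr.subC b) (AlgStr.subK b)).IsIrreducible ∧
      (AlgStr.quotientRep (AlgStr.subN b) (AlgStr.subU b)).IsIrreducible ∧
      -- the maximal submodules
      (∀ S : Subrepresentation (AlgStr.repΛ b),
        S ⋖ AlgStr.subC b ↔ S = AlgStr.subN b ∨ S = AlgStr.subK b) ∧
      -- the composition series
      (Odd n →
        (AlgStr.compositionSeriesOf (AlgStr.subC b)).encard = 2 ∧
        RelSeries.toList '' AlgStr.compositionSeriesOf (AlgStr.subC b) =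
          {[⊥, AlgStr.subMstarP b 1 1, AlgStr.subU b, AlgStr.subK b, AlgStr.subC b],
           [⊥, AlgStr.subMstarP b 1 1, AlgStr.subU b, AlgStr.subN b, AlgStr.subC b]}) ∧
      (Even n →
        AlgStr.IsDirectSum (AlgStr.subK b) (AlgStr.subU b) (AlgStr.subMstarP b 1 1) ∧
        (AlgStr.subU b).toRepresentation.IsIrreducible ∧
        (AlgStr.subMstarP b 1 1).toRepresentation.IsIrreducible ∧
        (AlgStr.compositionSeriesOf (AlgStr.subC b)).encard = 3 ∧
        RelSeries.toList '' AlgStr.compositionSeriesOf (AlgStr.subC b) =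
          {[⊥, AlgStr.subU b, AlgStr.subK b, AlgStr.subC b],
           [⊥, AlgStr.subMstarP b 1 1, AlgStr.subK b, AlgStr.subC b],
           [⊥, AlgStr.subU b, AlgStr.subN b, AlgStr.subC b]})) := by
  have hF' := AlgStr.exists_ne_zero_ne_one hF
  have hM := AlgStr.bot_lt_subMstarP (b := b) hn
  have hMC := AlgStr.subMstarP_lt_subC (b := b) hn
  have hNC := AlgStr.subN_lt_subC (b := b) hn
  have hNM := AlgStr.not_subN_le_subMstarP (b := b) hn
  -- a minimal submodule: everything below it is `0` or the module itself
  have hM' : ⊥ ⋖ AlgStr.subMstarP b 1 1 := ⟨hM, fun T h1 h2 =>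
    (AlgStr.eq_bot_or_eq_of_le_subMstarP h2.le).elim h1.ne' h2.ne⟩
  have hinf : ∀ S : Subrepresentation (AlgStr.repΛ b), ¬ AlgStr.subMstarP b 1 1 ≤ S →
      S ⊓ AlgStr.subMstarP b 1 1 = ⊥ := fun S hS =>
    (AlgStr.eq_bot_or_eq_of_le_subMstarP inf_le_right).resolve_right
      fun h => hS (inf_eq_right.1 h)
  refine ⟨fun hchar => ?_, fun hchar => ?_⟩
  · have h2 : (2 : F) ≠ 0 := fun h =>
      hchar (CharTwo.of_one_ne_zero_of_two_eq_zero one_ne_zero h)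
    have hcl := AlgStr.eq_of_le_subC_of_two_ne_zero (b := b) hn hF' h2
    refine ⟨AlgStr.properSubmodules_eq_of_two_ne_zero hn hF' h2, fun hdvd => ?_, fun hdvd => ?_⟩
    · have hc : (n : F) + 1 ≠ 0 := fun h => hdvd ((ringChar.spec F (n + 1)).1 (by exact_mod_cast h))
      have hMN : ¬ AlgStr.subMstarP b 1 1 ≤ AlgStr.subN b := fun h =>
        AlgStr.not_subMstarP_le_subT hn hc (h.trans inf_le_right)
      have hN : ⊥ < AlgStr.subN b := bot_lt_iff_ne_bot.2 fun h => hNM (h ▸ bot_le)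
      have hN' : ⊥ ⋖ AlgStr.subN b := ⟨hN, fun T h1 h2 => by
        rcases hcl T (h2.le.trans hNC.le) with rfl | rfl | rfl | rfl
        · exact lt_irrefl _ h1
        · exact hMN h2.le
        · exact lt_irrefl _ h2
        · exact h2.not_gt hNC⟩
      have hsup : AlgStr.subN b ⊔ AlgStr.subMstarP b 1 1 = AlgStr.subC b := by
        rcases hcl _ (sup_le hNC.le hMC.le) with h | h | h | h
        · exact (hM.not_ge (h ▸ le_sup_right)).elim
        · exact (hNM (sup_eq_right.1 h)).elim
        · exact (hMN (sup_eq_left.1 h)).elim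
        · exact h
      rw [AlgStr.encard_compositionSeriesOf, AlgStr.toList_image_compositionSeriesOf,
        AlgStr.chainsTo_bot_of_two_atoms hcl hM hN hMC hNC hMN hNM, Set.image_pair]
      refine ⟨AlgStr.subN_inf_subMstarstar h2 hc, ⟨hinf _ hMN, hsup⟩,
        AlgStr.isIrreducible_toRepresentation_of_covBy hN',
        AlgStr.isIrreducible_toRepresentation_of_covBy hM', Set.encard_pair fun h => ?_, rfl⟩
      simp only [List.cons.injEq, and_true, true_and] at h
      exact hNM h.le
    · have hc : (n : F) + 1 = 0 := by exact_mod_cast (ringChar.spec F (n + 1)).2 hdvd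
      have hMN : AlgStr.subMstarP b 1 1 < AlgStr.subN b :=
        lt_of_le_not_ge (le_inf hMC.le (AlgStr.subMstarP_le_subT hc)) hNM
      rw [AlgStr.encard_compositionSeriesOf, AlgStr.toList_image_compositionSeriesOf,
        AlgStr.chainsTo_bot_of_chain hcl hM hMN hNC, Set.image_singleton]
      exact ⟨Set.encard_singleton _, rfl⟩
  · have hcl := AlgStr.eq_of_le_subC_of_charTwo (b := b) hn hF'
    have hUN := AlgStr.subU_lt_subN (b := b) hn
    have hUK := AlgStr.subU_lt_subK (b := b) hn
    have hKC := AlgStr.subK_lt_subC (b := b) hn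
    have hUM := AlgStr.not_subU_le_subMstarP (b := b) hn
    have hNK := AlgStr.not_subN_le_subK (b := b) hn
    have hKN := AlgStr.not_subK_le_subN (b := b) hn
    have hMK := AlgStr.subMstarP_le_subK (b := b)
    have hcov := AlgStr.covBy_subC_iff_of_charTwo (b := b) hn hF'
    have hirr := AlgStr.isIrreducible_quotientRep_of_covBy ((hcov (AlgStr.subK b)).2 (Or.inr rfl))
    have hΓ := AlgStr.nonempty_quotientRep_equiv_repΓ (b := b)
    refine ⟨AlgStr.properSubmodules_eq_of_charTwo hn hF',
      AlgStr.encard_properSubmodules_of_charTwo hn hF', by rw [CharTwo.neg_eq],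
      AlgStr.subU_eq_inf, AlgStr.subN_sup_subK hn hF', hUN, hUK,
      AlgStr.nonempty_quotientRep_equiv_repDual rfl
        (AlgStr.exists_mem_subC_trForm_ne_zero (by omega)),
      AlgStr.nonempty_quotientRep_equiv_repDual rfl (AlgStr.exists_mem_subK_trForm_ne_zero hn),
      hΓ, hΓ.elim fun e => AlgStr.IsIrreducible.of_equiv e hirr, hirr,
      AlgStr.isIrreducible_quotientRep_of_covBy (AlgStr.subU_covBy_subN hn hF'), hcov,
      fun hodd => ?_, fun heven => ?_⟩
    · have hc : (n : F) + 1 = 0 := by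
        have := (CharP.cast_eq_zero_iff F 2 (n + 1)).2 hodd.add_one.two_dvd
        exact_mod_cast this
      have hMU : AlgStr.subMstarP b 1 1 < AlgStr.subU b :=
        lt_of_le_not_ge (le_inf hMK (AlgStr.subMstarP_le_subT hc)) hUM
      rw [AlgStr.encard_compositionSeriesOf, AlgStr.toList_image_compositionSeriesOf,
        AlgStr.chainsTo_bot_of_chain_of_diamond hcl hM hMU hUK hUN hKC hNC hKN hNK,
        Set.image_pair]
      refine ⟨Set.encard_pair fun h => ?_, rfl⟩
      simp only [List.cons.injEq, and_true, true_and] at h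
      exact hKN h.le
    · have hc : (n : F) + 1 ≠ 0 := fun h => by
        have h' := (CharP.cast_eq_zero_iff F 2 (n + 1)).1 (by exact_mod_cast h)
        have := heven.two_dvd
        omega
      have hMT := AlgStr.not_subMstarP_le_subT (b := b) hn hc
      have hMU : ¬ AlgStr.subMstarP b 1 1 ≤ AlgStr.subU b := fun h => hMT (h.trans inf_le_right)
      have hMN : ¬ AlgStr.subMstarP b 1 1 ≤ AlgStr.subN b := fun h => hMT (h.trans inf_le_right)
      have hMK' : AlgStr.subMstarP b 1 1 < AlgStr.subK b :=
        lt_of_le_not_ge hMK fun h => hUM (hUK.le.trans h)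
      have hU : ⊥ < AlgStr.subU b := bot_lt_iff_ne_bot.2 fun h => hUM (h ▸ bot_le)
      have hU' : ⊥ ⋖ AlgStr.subU b := ⟨hU, fun T h1 h2 => by
        rcases hcl T (h2.le.trans (hUN.trans hNC).le) with rfl | rfl | rfl | rfl | rfl | rfl
        · exact lt_irrefl _ h1
        · exact hMU h2.le
        · exact lt_irrefl _ h2
        · exact h2.not_gt hUK
        · exact h2.not_gt hUN
        · exact h2.not_gt (hUN.trans hNC)⟩
      have hsup : AlgStr.subU b ⊔ AlgStr.subMstarP b 1 1 = AlgStr.subK b :=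
        (AlgStr.eq_or_eq_of_inf_subT_le le_sup_left (sup_le hUK.le hMK)).resolve_left
          fun h => hMU (sup_eq_left.1 h)
      rw [AlgStr.encard_compositionSeriesOf, AlgStr.toList_image_compositionSeriesOf,
        AlgStr.chainsTo_bot_of_atom_of_diamond hcl hM hU hMK' hMN hUM hUK hUN hKC hNC hKN hNK,
        Set.image_insert_eq, Set.image_pair]
      refine ⟨⟨hinf _ hMU, hsup⟩, AlgStr.isIrreducible_toRepresentation_of_covBy hU',
        AlgStr.isIrreducible_toRepresentation_of_covBy hM',
        Set.encard_eq_three.2 ⟨_, _, _, fun h => ?_, fun h => ?_, fun h => ?_, rfl⟩, rfl⟩ <;>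
      simp only [List.cons.injEq, and_true, true_and] at h
      · exact hUM h.le
      · exact hKN h.le
      · exact hUM h.1.ge
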